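/- **Setting in one dimension.** Let $m\ge 0$ and $n\ge 2m+1$ be integers and $I=[0,1]$. Let $\ell_k$ be the Legendre polynomial of degree $k$ on $I$ with $\ell_k(1)=1$, let $L^0_k=\ell_k$ and $L^{\alpha+1}_k(x)=\int_0^x L^\alpha_k(t)\,dt$, and for $\alpha\in\{0,1\}$, $0\le\beta\le m$ let $h_{\alpha,\beta}$ be the polynomial of degree at most $2m+1$ whose derivatives of orders $0,\dots,m$ vanish at $0$ and $1$, except that $h_{\alpha,\beta}^{(\beta)}(\alpha)=1$. Identify $0$-forms $u$ and $1$-forms $v\,dx$ on $I$ with functions $u$, $v$. Node functionals for $0$-forms are $$\mathcal N^0_{2i+1}(u)=u^{(i+1)}(0),\quad \mathcal N^0_{2i+2}(u)=u^{(i+1)}(1)\quad(0\le i<m),$$ $$\mathcal N^0_{2m+i}(u)=\int_0^1\ell_{i-1}u'\,dx\quad(1\le i\le n-2m),\qquad \mathcal N^0_{n+1}(u)=u(1)+u(0),$$ with basis functions $\phi^0_{2j+1}=h_{0,j+1}$, $\phi^0_{2j+2}=h_{1,j+1}$ $(0\le j<m)$, $\phi^0_{2m+1}=\frac12(h_{1,0}-h_{0,0})$,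 $\phi^0_{2m+j}=L^{m+1}_{j+m-1}$ $(2\le j\le n-2m)$, $\phi^0_{n+1}=\frac12(h_{0,0}+h_{1,0})$. For $1$-forms, $$\mathcal N^1_{2i+1}(v)=v^{(i)}(0),\quad \mathcal N^1_{2i+2}(v)=v^{(i)}(1)\quad(0\le i<m),\qquad \mathcal N^1_{2m+i}(v)=\int_0^1\ell_{i-1}v\,dx\quad(1\le i\le n-2m),$$ with basis functions $\phi^1_j=(\phi^0_j)'$, $1\le j\le n$. For $k=0,1$ let $M_k=(\mathcal N^k_i(\phi^k_j))_{ij}$ and let $I_ku=\sum_j c_j\phi^k_j$ with $c=M_k^{-1}(\mathcal N^k_i(u))_i$ be the interpolation operator. **Setting in $N$ dimensions.** Let $\chi_\nu=\{\mathbf i\in\{0,1\}^N:\sum_\ell i_\ell=\nu\}$ and, for $\mathbf i\in\chi_\nu$, let $dx^{\mathbf i}$ be the wedge product, in increasing order, of the $dx_\ell$ with $i_\ell=1$. Smooth forms on the closed cube $I^N$ are written $u=\sum_{\mathbf i\in\chi_\nu}u_{\mathbf i}\,dx^{\mathbf i}\in C^\infty\Lambda^\nu(I^N)$. The tensor product interpolation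 operator is $$I^{\otimes N}_\nu u=\sum_{\mathbf i\in\chi_\nu}\bigl((I_{i_1}\otimes\cdots\otimes I_{i_N})u_{\mathbf i}\bigr)\,dx^{\mathbf i},$$ where the $\ell$-th factor acts on the $\ell$-th variable. The tensor product space $V^\nu=(\mathbb P\Lambda^{\otimes N})^\nu$ is the span of the forms $p_1(x_1)\cdots p_N(x_N)\,dx^{\mathbf i}$ with $\mathbf i\in\chi_\nu$ and polynomials $p_\ell$ of degree at most $n-i_\ell$. **Lemma 2.** For all $N,\nu\ge 0$, $m\ge0$ and $n\ge 2m+1$: 1. $I^{\otimes N}_\nu$ is a cochain map: $I^{\otimes N}_{\nu+1}\,du=d\,I^{\otimes N}_\nu u$ on $I^N$ for all $u\in C^\infty\Lambda^\nu(I^N)$. 2. The spaces $V^\nu$ form a subcomplex of the de Rham complex: $V^\nu\subset C^\infty\Lambda^\nu(I^N)$ and $dV^\nu\subset V^{\nu+1}$. 3. $I^{\otimes N}_\nu$ is a projection onto $V^\nu$: $I^{\otimes N}_\nu u\in V^\nu$ for every $u\in C^\infty\Lambda^\nu(I^N)$, and $I^{\otimes N}_\nu w=w$ on $I^N$ for every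 $w\in V^\nu$. 4. The elements are $C^m$-conforming: let $u,v\in C^\infty\Lambda^\nu(I^N)$, $1\le\ell\le N$ and $a,b\in\{0,1\}$, and suppose that for all $\mathbf i\in\chi_\nu$ and all $\gamma\ge0$ with $\gamma+i_\ell\le m$ the trace of $\partial_\ell^\gamma u_{\mathbf i}$ on the face $x_\ell=a$ equals the trace of $\partial_\ell^\gamma v_{\mathbf i}$ on the face $x_\ell=b$ (as functions of the other variables). Then the same holds for $I^{\otimes N}_\nu u$ and $I^{\otimes N}_\nu v$ in place of $u$ and $v$. -/

import Mathlib

open scoped ContDiff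

noncomputable section

namespace TPFE

open Polynomial

/-! ### Polynomials on the reference interval `[0, 1]` -/

/-- Legendre polynomial `ℓ_k` of degree `k` on `[0, 1]`, normalized by `ℓ_k(1) = 1`
(the shifted Legendre polynomial of Mathlib takes the value `(-1)^k` at `1`). -/
def legendre (k : ℕ) : ℝ[X] :=
  C ((-1 : ℝ) ^ k) * (Polynomial.shiftedLegendre k).map (Int.castRingHom ℝ)

/-- The antiderivative `x ↦ ∫₀ˣ p(t) dt` of a polynomial. -/
def antideriv (p : ℝ[X]) : ℝ[X] :=
  p.sum fun k a => monomial (k + 1) (a / ((k : ℝ) + 1))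

/-- `L^α_j`, the `α`-fold integral from `0` of the Legendre polynomial `ℓ_j`. -/
def integratedLegendre (α j : ℕ) : ℝ[X] :=
  antideriv^[α] (legendre j)

/-- `h_{0,β}` for `β ≤ m`: the polynomial of degree at most `2m+1` whose derivatives of order
`0, …, m` vanish at `0` and at `1`, except that the `β`-th derivative at `0` equals `1`
(see `hermiteLeft_at_zero`, `hermiteLeft_at_one`). -/
def hermiteLeft (m β : ℕ) : ℝ[X] :=
  C ((β.factorial : ℝ)⁻¹) * X ^ β *
    ((1 - X) ^ (m + 1) * ∑ k ∈ Finset.range (m - β + 1), C ((m + k).choose m : ℝ) * X ^ k)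

/-- `h_{1,β}` for `β ≤ m`: the polynomial of degree at most `2m+1` whose derivatives of order
`0, …, m` vanish at `0` and at `1`, except that the `β`-th derivative at `1` equals `1`
(see `hermiteRight_at_zero`, `hermiteRight_at_one`). -/
def hermiteRight (m β : ℕ) : ℝ[X] :=
  C ((-1 : ℝ) ^ β) * (hermiteLeft m β).comp (1 - X)

theorem hermite_coeff_aux (m r d : ℕ) (hd : d ≤ r) :
    ((1 - X : ℝ[X]) ^ (m + 1) *
      ∑ k ∈ Finset.range (r + 1), C ((m + k).choose m : ℝ) * X ^ k).coeff d
      = if d = 0 then 1 else 0 := by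
  have h := PowerSeries.mk_add_choose_mul_one_sub_pow_eq_one ℝ m
  have h2 := congrArg (PowerSeries.coeff d) h
  rw [PowerSeries.coeff_one, mul_comm, PowerSeries.coeff_mul] at h2
  rw [← h2, Polynomial.coeff_mul]
  refine Finset.sum_congr rfl fun p hp => ?_
  have hp' := Finset.HasAntidiagonal.mem_antidiagonal.1 hp
  congr 1
  · rw [← Polynomial.coeff_coe]; simp
  · simp [Polynomial.finsetSum_coeff, Polynomial.coeff_X_pow]
    omega

theorem hermiteLeft_at_zero (m β γ : ℕ) (hβ : β ≤ m) (hγ : γ ≤ m) :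
    (derivative^[γ] (hermiteLeft m β)).eval 0 = if β = γ then 1 else 0 := by
  rw [← coeff_zero_eq_eval_zero, coeff_iterate_derivative, zero_add, Nat.descFactorial_self,
    hermiteLeft, mul_assoc, coeff_C_mul, coeff_X_pow_mul']
  split_ifs with h1 h2 h2
  · subst h2
    rw [Nat.sub_self, hermite_coeff_aux _ _ _ (Nat.zero_le _)]
    simp [Nat.factorial_ne_zero]
  · rw [hermite_coeff_aux _ _ _ (by omega), if_neg (by omega)]
    simp
  · omega
  · simp

theorem hermiteLeft_at_one (m β γ : ℕ) (hγ : γ ≤ m) :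
    (derivative^[γ] (hermiteLeft m β)).eval 1 = 0 := by
  have h : (1 - X : ℝ[X]) ^ (m + 1) ∣ hermiteLeft m β :=
    Dvd.dvd.mul_left (Dvd.intro _ rfl) _
  have h1 : (1 - X : ℝ[X]) ∣ derivative^[γ] (hermiteLeft m β) :=
    (dvd_pow_self _ (by omega)).trans (pow_sub_dvd_iterate_derivative_of_pow_dvd γ h)
  obtain ⟨q, hq⟩ := h1
  simp [hq]

theorem hermiteRight_at_one (m β γ : ℕ) (hβ : β ≤ m) (hγ : γ ≤ m) :
    (derivative^[γ] (hermiteRight m β)).eval 1 = if β = γ then 1 else 0 := by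
  rw [hermiteRight, iterate_derivative_C_mul, iterate_derivative_comp_one_sub_X]
  simp only [eval_mul, eval_C, eval_pow, eval_neg, eval_one, eval_comp, eval_sub, eval_X, sub_self,
    hermiteLeft_at_zero m β γ hβ hγ]
  split_ifs with h
  · subst h
    rw [mul_one, ← mul_pow]; simp
  · simp

theorem hermiteRight_at_zero (m β γ : ℕ) (hγ : γ ≤ m) :
    (derivative^[γ] (hermiteRight m β)).eval 0 = 0 := by
  rw [hermiteRight, iterate_derivative_C_mul, iterate_derivative_comp_one_sub_X]
  simp [hermiteLeft_at_one m β γ hγ]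

/-! ### The finite elements in one dimension

Forms on `[0, 1]` are represented by their proxies: a `0`-form by a function `u`, a `1`-form
`v dx` by the function `v`. Node functionals and basis functions are numbered from `0`. -/

/-- The `j`-th node functional for `0`-forms, `0 ≤ j ≤ n`: derivatives of order `1, …, m` at the
two end points, then the moments of `u'` against `ℓ_0, …, ℓ_{n-2m-1}`, then `u(1) + u(0)`. -/
def node0 (m n : ℕ) (j : Fin (n + 1)) (u : ℝ → ℝ) : ℝ :=
  if (j : ℕ) < 2 * m then
    iteratedDerivWithin ((j : ℕ) / 2 + 1) u (Set.Icc 0 1) (if (j : ℕ) % 2 = 0 then 0 else 1)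
  else if (j : ℕ) < n then
    ∫ x in (0 : ℝ)..1, (legendre ((j : ℕ) - 2 * m)).eval x * derivWithin u (Set.Icc 0 1) x
  else u 1 + u 0

/-- The `j`-th basis function for `0`-forms, `0 ≤ j ≤ n`. -/
def basis0 (m n : ℕ) (j : Fin (n + 1)) : ℝ[X] :=
  if (j : ℕ) < 2 * m then
    if (j : ℕ) % 2 = 0 then hermiteLeft m ((j : ℕ) / 2 + 1) else hermiteRight m ((j : ℕ) / 2 + 1)
  else if (j : ℕ) = n then C (1 / 2) * (hermiteLeft m 0 + hermiteRight m 0)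
  else if (j : ℕ) = 2 * m then C (1 / 2) * (hermiteRight m 0 - hermiteLeft m 0)
  else integratedLegendre (m + 1) ((j : ℕ) - m)

/-- The `j`-th node functional for `1`-forms, `0 ≤ j < n`: derivatives of order `0, …, m-1` at the
two end points, then the moments of `v` against `ℓ_0, …, ℓ_{n-2m-1}`. -/
def node1 (m n : ℕ) (j : Fin n) (v : ℝ → ℝ) : ℝ :=
  if (j : ℕ) < 2 * m then
    iteratedDerivWithin ((j : ℕ) / 2) v (Set.Icc 0 1) (if (j : ℕ) % 2 = 0 then 0 else 1)
  else ∫ x in (0 : ℝ)..1, (legendre ((j : ℕ) - 2 * m)).eval x * v x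

/-- The `j`-th basis function for `1`-forms, `0 ≤ j < n`. -/
def basis1 (m n : ℕ) (j : Fin n) : ℝ[X] :=
  derivative (basis0 m n j.castSucc)

/-- The matrix of node functionals applied to basis functions. -/
def nodalMatrix {ι : Type} (node : ι → (ℝ → ℝ) → ℝ) (φ : ι → ℝ[X]) : Matrix ι ι ℝ :=
  Matrix.of fun i j => node i fun x => (φ j).eval x

/-- Finite element interpolation: the element `∑ⱼ cⱼ φⱼ` of the span of the basis functions whose
coefficients solve `∑ⱼ 𝒩ᵢ(φⱼ) cⱼ = 𝒩ᵢ(u)` for all `i`. -/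
def interpolate {ι : Type} [Fintype ι] [DecidableEq ι] (node : ι → (ℝ → ℝ) → ℝ) (φ : ι → ℝ[X])
    (u : ℝ → ℝ) (x : ℝ) : ℝ :=
  ∑ i, node i u * ∑ j, (nodalMatrix node φ)⁻¹ j i * (φ j).eval x

/-- The one-dimensional interpolation operators `I_0` and `I_1`. -/
def interp (m n : ℕ) (k : Fin 2) : (ℝ → ℝ) → ℝ → ℝ :=
  if k = 0 then interpolate (node0 m n) (basis0 m n) else interpolate (node1 m n) (basis1 m n)

/-! ### Differential forms on the cube -/

/-- The cube `[0, 1]^N`. -/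
def cube (N : ℕ) : Set (Fin N → ℝ) := Set.Icc 0 1

/-- Differential `ν`-forms in `N` variables; on the cube, only the values there matter. -/
abbrev Form (N ν : ℕ) : Type := (Fin N → ℝ) → (Fin N → ℝ) [⋀^Fin ν]→L[ℝ] ℝ

/-- Smooth `ν`-forms on the (closed) cube. -/
def IsSmooth {N ν : ℕ} (u : Form N ν) : Prop := ContDiffOn ℝ ∞ u (cube N)

/-- The exterior derivative of a form on the cube. -/
def dForm {N ν : ℕ} (u : Form N ν) : Form N (ν + 1) := extDerivWithin u (cube N)

/-- The index set `χ_ν` of the vectors `i ∈ {0,1}^N` with `∑ i_ℓ = ν`. -/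
abbrev Chi (N ν : ℕ) : Type := {i : Fin N → Fin 2 // ∑ l, (i l : ℕ) = ν}

/-- The set of the `ℓ` with `i_ℓ = 1`. -/
def Chi.support {N ν : ℕ} (i : Chi N ν) : Finset (Fin N) := Finset.univ.filter fun l => i.1 l = 1

theorem Chi.card_support {N ν : ℕ} (i : Chi N ν) : i.support.card = ν := by
  rw [Chi.support, Finset.card_filter]
  refine (Finset.sum_congr rfl fun l _ => ?_).trans i.2
  generalize i.1 l = k
  fin_cases k <;> simp

/-- The increasing enumeration of the `ℓ` with `i_ℓ = 1`. -/
def Chi.dirs {N ν : ℕ} (i : Chi N ν) : Fin ν ↪o Fin N := i.support.orderEmbOfFin i.card_support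

/-- The basic form `dx^i = dx_{ℓ_1} ∧ ⋯ ∧ dx_{ℓ_ν}`, where `ℓ_1 < ⋯ < ℓ_ν` are the `ℓ` with
`i_ℓ = 1`: its value on `v_1, …, v_ν` is `det (dx_{ℓ_b} v_a)`. -/
def Chi.dx {N ν : ℕ} (i : Chi N ν) : (Fin N → ℝ) [⋀^Fin ν]→L[ℝ] ℝ where
  toMultilinearMap := ((Matrix.detRowAlternating (n := Fin ν) (R := ℝ)).compLinearMap
    (LinearMap.funLeft ℝ ℝ i.dirs)).toMultilinearMap
  map_eq_zero_of_eq' := ((Matrix.detRowAlternating (n := Fin ν) (R := ℝ)).compLinearMap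
    (LinearMap.funLeft ℝ ℝ i.dirs)).map_eq_zero_of_eq'
  cont := by
    change Continuous fun v : Fin ν → Fin N → ℝ => Matrix.det (fun a b => v a (i.dirs b))
    refine Continuous.matrix_det ?_
    fun_prop

/-- The coefficient `u_i` of `u = ∑_i u_i dx^i`. -/
def Form.coeff {N ν : ℕ} (u : Form N ν) (i : Chi N ν) (x : Fin N → ℝ) : ℝ :=
  u x fun b => Pi.single (i.dirs b) 1

/-! ### Tensor products -/

/-- The tensor product `A_1 ⊗ ⋯ ⊗ A_N` of operators on functions of one variable: `A_ℓ` acts on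
the `ℓ`-th variable, the other variables being fixed. -/
def tensorOp : {N : ℕ} → (Fin N → (ℝ → ℝ) → ℝ → ℝ) → ((Fin N → ℝ) → ℝ) → (Fin N → ℝ) → ℝ
  | 0, _, f, x => f x
  | _ + 1, A, f, x =>
      A 0 (fun t => tensorOp (fun l => A l.succ) (fun y => f (Fin.cons t y)) (Fin.tail x)) (x 0)

/-- The tensor product interpolation operator `∑_{i ∈ χ_ν} I_{i_1} ⊗ ⋯ ⊗ I_{i_N}` on `ν`-forms; the
summand with index `i` acts on the component `u_i dx^i` and annihilates the others. -/
def tensorInterp (m n : ℕ) {N ν : ℕ} (u : Form N ν) : Form N ν := fun x =>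
  ∑ i : Chi N ν, tensorOp (fun l => interp m n (i.1 l)) (u.coeff i) x • i.dx

/-- The rank-one form `(⨂_ℓ p_ℓ) dx^i`. -/
def rankOne {N ν : ℕ} (i : Chi N ν) (p : Fin N → ℝ[X]) : Form N ν := fun x =>
  (∏ l, (p l).eval (x l)) • i.dx

/-- The tensor product space `⨁_{i ∈ χ_ν} P_{n-i_1}Λ^{i_1} ⊗ ⋯ ⊗ P_{n-i_N}Λ^{i_N}`. -/
def tensorSpace (n N ν : ℕ) : Submodule ℝ (Form N ν) :=
  Submodule.span ℝ
    {w | ∃ (i : Chi N ν) (p : Fin N → ℝ[X]),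
      (∀ l, p l ∈ degreeLE ℝ ((n - (i.1 l : ℕ) : ℕ) : WithBot ℕ)) ∧ w = rankOne i p}

/-- The `γ`-th partial derivative in the `l`-th variable of a function on the cube. -/
def partialDeriv {N : ℕ} (l : Fin N) (γ : ℕ) (f : (Fin N → ℝ) → ℝ) (x : Fin N → ℝ) : ℝ :=
  iteratedDerivWithin γ (fun t => f (Function.update x l t)) (Set.Icc 0 1) (x l)

/-- The traces of `u` on the face `x_l = a` and of `v` on the face `x_l = b` agree to the order
required by `C^m` forms: for each `i`, the normal derivatives of order `0, …, m - i_l` of the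
coefficients `u_i` and `v_i`. -/
def SameTraces (m : ℕ) {N ν : ℕ} (l : Fin N) (a b : ℝ) (u v : Form N ν) : Prop :=
  ∀ (i : Chi N ν) (γ : ℕ), γ + (i.1 l : ℕ) ≤ m → ∀ x ∈ cube N,
    partialDeriv l γ (u.coeff i) (Function.update x l a) =
      partialDeriv l γ (v.coeff i) (Function.update x l b)

end TPFE

end

/-
In one variable the node functionals are unisolvent: a polynomial of degree `< n` whose derivatives
of order `< m` vanish at both end points is `(x (1 - x))^m q`, and the Legendre moments make it
orthogonal to `q`. Since the functionals for `0`-forms, except the last, are those for `1`-forms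
applied to the derivative, interpolation commutes with `d/dx`, reproduces polynomials and preserves
the end point derivatives that are node functionals.

In several variables each of these facts has to be applied in one variable at a time, although the
iterated operators single out the first one. Every node functional is an integral of a derivative
against a polynomial with respect to a finite measure on `[0, 1]`, so a tensor product of node
functionals is an integral of a mixed partial derivative over the cube, and by Fubini's theorem any
variable may be separated from the others. On forms the claims are then compared coefficient by
coefficient in the basis `dx^i`.
-/

noncomputable section

namespace TPFE

open Polynomial MeasureTheory Set

/-! ### Moment functionals on the unit interval -/

theorem integrable_of_continuousOn_of_ae_mem {α : Type*} [TopologicalSpace α] [T2Space α]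
    [MeasurableSpace α] [OpensMeasurableSpace α]
    {μ : Measure α} [IsFiniteMeasure μ] {s : Set α}
    (hs : IsCompact s) (hμ : ∀ᵐ x ∂μ, x ∈ s) {g : α → ℝ} (hg : ContinuousOn g s) :
    Integrable g μ := by
  have h := hg.integrableOn_compact' (μ := μ) hs hs.measurableSet
  rwa [IntegrableOn, Measure.restrict_eq_self_of_ae_mem hμ] at h

theorem contDiff_eval (p : ℝ[X]) : ContDiff ℝ ∞ fun t => p.eval t := by
  simpa using p.contDiff_aeval (𝕜 := ℝ) ∞

/-- A functional `f ↦ ∫ w(t) f⁽ʳ⁾(t) dμ(t)` on functions on `[0, 1]`. All node functionals have this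
form, and it makes sense for the partial derivatives of a function of several variables as well,
so that tensor products of node functionals become integrals over the cube. -/
structure MomentFunctional where
  order : ℕ
  weight : ℝ[X]
  measure : Measure ℝ
  isFiniteMeasure : IsFiniteMeasure measure
  ae_mem : ∀ᵐ t ∂measure, t ∈ Icc (0 : ℝ) 1

namespace MomentFunctional

attribute [instance] MomentFunctional.isFiniteMeasure

/-- The value `∫ w(t) f⁽ʳ⁾(t) dμ(t)`. -/
def toFun (F : MomentFunctional) (f : ℝ → ℝ) : ℝ :=
  ∫ t, F.weight.eval t * iteratedDerivWithin F.order f (Icc 0 1) t ∂F.measure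

instance : CoeFun MomentFunctional fun _ => (ℝ → ℝ) → ℝ := ⟨toFun⟩

theorem congr_of_eqOn (F : MomentFunctional) {f g : ℝ → ℝ} (h : EqOn f g (Icc 0 1)) :
    F f = F g :=
  integral_congr_ae (F.ae_mem.mono fun t ht => by
    simp only [iteratedDerivWithin_congr h ht])

theorem integrable (F : MomentFunctional) {f : ℝ → ℝ} (hf : ContDiffOn ℝ ∞ f (Icc 0 1)) :
    Integrable (fun t => F.weight.eval t * iteratedDerivWithin F.order f (Icc 0 1) t)
      F.measure :=
  integrable_of_continuousOn_of_ae_mem isCompact_Icc F.ae_mem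
    (F.weight.continuous.continuousOn.mul
      (hf.continuousOn_iteratedDerivWithin (mod_cast le_top) (uniqueDiffOn_Icc zero_lt_one)))

/-- The restriction of a moment functional to polynomials, as a linear form. -/
def onPolynomial (F : MomentFunctional) : ℝ[X] →ₗ[ℝ] ℝ where
  toFun p := F fun t => p.eval t
  map_add' p q := by
    simp only [toFun]
    rw [← integral_add (F.integrable (contDiff_eval p).contDiffOn)
      (F.integrable (contDiff_eval q).contDiffOn)]
    refine integral_congr_ae (F.ae_mem.mono fun t ht => ?_)
    simp only [eval_add]
    rw [iteratedDerivWithin_fun_add ht (uniqueDiffOn_Icc zero_lt_one)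
      ((contDiff_eval p).contDiffWithinAt.of_le (mod_cast le_top))
      ((contDiff_eval q).contDiffWithinAt.of_le (mod_cast le_top)), mul_add]
  map_smul' c p := by
    simp only [toFun, eval_smul, smul_eq_mul, iteratedDerivWithin_const_mul_field, RingHom.id_apply,
      mul_left_comm _ c, integral_const_mul]

theorem onPolynomial_apply (F : MomentFunctional) (p : ℝ[X]) :
    F.onPolynomial p = F fun t => p.eval t :=
  rfl

/-- The functional `f ↦ F f'`. -/
def compDeriv (F : MomentFunctional) : MomentFunctional where
  order := F.order + 1
  weight := F.weight
  measure := F.measure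
  isFiniteMeasure := F.isFiniteMeasure
  ae_mem := F.ae_mem

theorem compDeriv_apply (F : MomentFunctional) (f : ℝ → ℝ) :
    F.compDeriv f = F (derivWithin f (Icc 0 1)) := by
  simp only [toFun, compDeriv, iteratedDerivWithin_succ']

theorem compDeriv_onPolynomial (F : MomentFunctional) (p : ℝ[X]) :
    F.compDeriv.onPolynomial p = F.onPolynomial (derivative p) := by
  rw [onPolynomial_apply, compDeriv_apply]
  exact F.congr_of_eqOn fun t ht => p.derivWithin (uniqueDiffOn_Icc zero_lt_one t ht)

/-- The functional `f ↦ f⁽ʳ⁾(a)`. -/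
def pointDeriv (r : ℕ) (a : Icc (0 : ℝ) 1) : MomentFunctional where
  order := r
  weight := 1
  measure := Measure.dirac a
  isFiniteMeasure := inferInstance
  ae_mem := by simp only [ae_dirac_eq, Filter.eventually_pure, Subtype.coe_prop]

theorem pointDeriv_apply (r : ℕ) (a : Icc (0 : ℝ) 1) (f : ℝ → ℝ) :
    pointDeriv r a f = iteratedDerivWithin r f (Icc 0 1) a := by
  simp [toFun, pointDeriv]

theorem pointDeriv_onPolynomial (r : ℕ) (a : Icc (0 : ℝ) 1) (p : ℝ[X]) :
    (pointDeriv r a).onPolynomial p = (derivative^[r] p).eval (a : ℝ) := by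
  induction r generalizing p with
  | zero => simp [onPolynomial_apply, pointDeriv_apply]
  | succ r ih => exact (compDeriv_onPolynomial (pointDeriv r a) p).trans (ih _)

/-- The functional `f ↦ ∫₀¹ w f`. -/
def moment (w : ℝ[X]) : MomentFunctional where
  order := 0
  weight := w
  measure := volume.restrict (Icc 0 1)
  isFiniteMeasure := inferInstance
  ae_mem := ae_restrict_mem measurableSet_Icc

theorem moment_apply (w : ℝ[X]) (f : ℝ → ℝ) :
    moment w f = ∫ t in (0 : ℝ)..1, w.eval t * f t := by
  simp only [toFun, moment, iteratedDerivWithin_zero]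
  rw [integral_Icc_eq_integral_Ioc, intervalIntegral.integral_of_le zero_le_one]

/-- The functional `f ↦ f(1) + f(0)`. -/
def endpointSum : MomentFunctional where
  order := 0
  weight := 1
  measure := Measure.dirac 1 + Measure.dirac 0
  isFiniteMeasure := inferInstance
  ae_mem := by simp [ae_add_measure_iff, ae_dirac_eq]

theorem endpointSum_apply (f : ℝ → ℝ) : endpointSum f = f 1 + f 0 := by
  simp only [toFun, endpointSum, iteratedDerivWithin_zero, eval_one, one_mul]
  rw [integral_add_measure (integrable_dirac (by simp)) (integrable_dirac (by simp)),
    integral_dirac, integral_dirac]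

theorem moment_one_derivWithin {f : ℝ → ℝ} (hf : ContDiffOn ℝ ∞ f (Icc 0 1)) :
    moment 1 (derivWithin f (Icc 0 1)) = f 1 - f 0 := by
  have hs := uniqueDiffOn_Icc (zero_lt_one (α := ℝ))
  simp only [moment_apply, eval_one, one_mul]
  refine intervalIntegral.integral_eq_sub_of_hasDerivAt_of_le zero_le_one hf.continuousOn
    (fun t ht => (hf.differentiableOn (by simp) t
      (Ioo_subset_Icc_self ht)).hasDerivWithinAt.hasDerivAt (Icc_mem_nhds ht.1 ht.2)) ?_
  exact (hf.continuousOn_derivWithin hs (by simp)).intervalIntegrable_of_Icc zero_le_one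

end MomentFunctional

open MomentFunctional

/-- The `j`-th node functional for `1`-forms; even `j < 2m` belong to the left end point. -/
def nodeFunctional1 (m n : ℕ) (j : Fin n) : MomentFunctional :=
  if (j : ℕ) < 2 * m then pointDeriv (j / 2) (if (j : ℕ) % 2 = 0 then 0 else 1)
  else moment (legendre (j - 2 * m))

/-- The `j`-th node functional for `0`-forms. Apart from the last one, they are those for `1`-forms
applied to the derivative. -/
def nodeFunctional0 (m n : ℕ) : Fin (n + 1) → MomentFunctional :=
  Fin.snoc (α := fun _ => MomentFunctional) (fun j => (nodeFunctional1 m n j).compDeriv) endpointSum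

section NodeFunctionals

variable {m n : ℕ}

theorem nodeFunctional0_castSucc (j : Fin n) :
    nodeFunctional0 m n j.castSucc = (nodeFunctional1 m n j).compDeriv :=
  Fin.snoc_castSucc (α := fun _ => MomentFunctional) ..

theorem nodeFunctional0_last : nodeFunctional0 m n (Fin.last n) = endpointSum :=
  Fin.snoc_last (α := fun _ => MomentFunctional) ..

theorem node1_eq_nodeFunctional1 (j : Fin n) (f : ℝ → ℝ) :
    node1 m n j f = nodeFunctional1 m n j f := by
  unfold node1 nodeFunctional1
  split_ifs <;> simp only [pointDeriv_apply, moment_apply, Icc.coe_zero, Icc.coe_one]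

theorem node0_eq_nodeFunctional0 (hn : 2 * m ≤ n) (j : Fin (n + 1)) (f : ℝ → ℝ) :
    node0 m n j f = nodeFunctional0 m n j f := by
  cases j using Fin.lastCases with
  | last =>
    rw [nodeFunctional0_last, endpointSum_apply, node0, if_neg (by simpa using hn),
      if_neg (by simp)]
  | cast j =>
    rw [nodeFunctional0_castSucc, compDeriv_apply, ← node1_eq_nodeFunctional1, node0, node1]
    simp only [Fin.val_castSucc, j.isLt, if_true, iteratedDerivWithin_succ']

theorem nodeFunctional1_left {i : ℕ} (hi : i < m) (hin : 2 * i < n) :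
    nodeFunctional1 m n ⟨2 * i, hin⟩ = pointDeriv i 0 := by
  simp [nodeFunctional1, hi]

theorem nodeFunctional1_right {i : ℕ} (hi : i < m) (hin : 2 * i + 1 < n) :
    nodeFunctional1 m n ⟨2 * i + 1, hin⟩ = pointDeriv i 1 := by
  have h₁ : 2 * i + 1 < 2 * m := by omega
  have h₂ : (2 * i + 1) / 2 = i := by omega
  simp [nodeFunctional1, h₁, h₂]

theorem nodeFunctional1_moment {i : ℕ} (hin : 2 * m + i < n) :
    nodeFunctional1 m n ⟨2 * m + i, hin⟩ = moment (legendre i) := by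
  simp [nodeFunctional1]

end NodeFunctionals

/-! ### Interpolation by unisolvent functionals -/

/-- An operator `f ↦ ∑ⱼ Fⱼ(f) φⱼ` with moment functionals `Fⱼ` and polynomials `φⱼ`. -/
structure FiniteRankOperator where
  Index : Type
  fintype : Fintype Index
  functional : Index → MomentFunctional
  shape : Index → ℝ[X]

namespace FiniteRankOperator

attribute [instance] FiniteRankOperator.fintype

/-- The value `∑ⱼ Fⱼ(f) φⱼ` as a polynomial. -/
def toPolynomial (T : FiniteRankOperator) (f : ℝ → ℝ) : ℝ[X] :=
  ∑ j, T.functional j f • T.shape j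

/-- The value `∑ⱼ Fⱼ(f) φⱼ` as a function. -/
def op (T : FiniteRankOperator) (f : ℝ → ℝ) (x : ℝ) : ℝ := (T.toPolynomial f).eval x

theorem op_apply (T : FiniteRankOperator) (f : ℝ → ℝ) (x : ℝ) :
    T.op f x = ∑ j, T.functional j f * (T.shape j).eval x := by
  simp [op, toPolynomial, eval_finsetSum]

theorem op_congr_of_eqOn (T : FiniteRankOperator) {f g : ℝ → ℝ} (h : EqOn f g (Icc 0 1)) :
    T.op f = T.op g := by
  simp only [funext_iff, op_apply, (T.functional _).congr_of_eqOn h, implies_true]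

theorem toPolynomial_mem {T : FiniteRankOperator} {V : Submodule ℝ ℝ[X]}
    (hV : ∀ j, T.shape j ∈ V) (f : ℝ → ℝ) : T.toPolynomial f ∈ V :=
  V.sum_mem fun j _ => V.smul_mem _ (hV j)

/-- The finite element with node functionals `F` and basis functions `φ`: its shapes are the
combinations of the `φᵢ` dual to `F`. -/
def ofBasis {ι : Type} [Fintype ι] [DecidableEq ι] (F : ι → MomentFunctional) (φ : ι → ℝ[X]) :
    FiniteRankOperator where
  Index := ι
  fintype := inferInstance
  functional := F
  shape j := ∑ i, (nodalMatrix (fun i => F i) φ)⁻¹ i j • φ i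

variable {ι : Type} [Fintype ι] [DecidableEq ι] {F : ι → MomentFunctional} {φ : ι → ℝ[X]}
  {V : Submodule ℝ ℝ[X]}

theorem op_ofBasis (F : ι → MomentFunctional) (φ : ι → ℝ[X]) :
    (ofBasis F φ).op = interpolate (fun i => F i) φ := by
  ext f x
  refine (op_apply _ f x).trans (Finset.sum_congr rfl fun j _ => ?_)
  simp [ofBasis, eval_finsetSum]

theorem shape_ofBasis_mem (hV : ∀ j, φ j ∈ V) (j : ι) : (ofBasis F φ).shape j ∈ V :=
  V.sum_mem fun i _ => V.smul_mem _ (hV i)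

/-- A polynomial in `V` is determined by the values of the functionals `F`. -/
def Unisolvent {ι : Type} (F : ι → MomentFunctional) (V : Submodule ℝ ℝ[X]) : Prop :=
  ∀ p ∈ V, (∀ i, (F i).onPolynomial p = 0) → p = 0

theorem Unisolvent.isUnit_nodalMatrix (hF : Unisolvent F V) (hV : ∀ j, φ j ∈ V)
    (hφ : LinearIndependent ℝ φ) : IsUnit (nodalMatrix (fun i => F i) φ) := by
  rw [← Matrix.mulVec_injective_iff_isUnit, ← Matrix.coe_mulVecLin, injective_iff_map_eq_zero]
  intro c hc
  have hp : ∑ j, c j • φ j = 0 := by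
    refine hF _ (V.sum_mem fun j _ => V.smul_mem _ (hV j)) fun i => ?_
    have hi := congrFun hc i
    simpa [Matrix.mulVec, dotProduct, nodalMatrix, MomentFunctional.onPolynomial_apply,
      mul_comm] using hi
  exact funext (Fintype.linearIndependent_iff.1 hφ c hp)

theorem Unisolvent.onPolynomial_toPolynomial (hF : Unisolvent F V) (hV : ∀ j, φ j ∈ V)
    (hφ : LinearIndependent ℝ φ) (f : ℝ → ℝ) (i : ι) :
    (F i).onPolynomial ((ofBasis F φ).toPolynomial f) = F i f := by
  have hdet := (Matrix.isUnit_iff_isUnit_det _).1 (hF.isUnit_nodalMatrix hV hφ)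
  set M := nodalMatrix (fun i => F i) φ
  have hMM := congrFun (congrArg (·.mulVec fun j => F j f) (Matrix.mul_nonsing_inv M hdet)) i
  simp only [Matrix.one_mulVec] at hMM
  refine Eq.trans ?_ hMM
  simp only [toPolynomial, ofBasis, map_sum, map_smul, smul_eq_mul, Matrix.mulVec, dotProduct,
    Matrix.mul_apply]
  refine Finset.sum_congr rfl fun j _ => ?_
  rw [mul_comm]
  congr 1
  exact Finset.sum_congr rfl fun l _ => mul_comm _ _

theorem Unisolvent.toPolynomial_eq (hF : Unisolvent F V) (hV : ∀ j, φ j ∈ V)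
    (hφ : LinearIndependent ℝ φ) {f : ℝ → ℝ} {q : ℝ[X]} (hq : q ∈ V)
    (hfq : ∀ i, (F i).onPolynomial q = F i f) : (ofBasis F φ).toPolynomial f = q := by
  refine sub_eq_zero.1 (hF _ (V.sub_mem (toPolynomial_mem (shape_ofBasis_mem hV) f) hq) fun i => ?_)
  rw [map_sub, hF.onPolynomial_toPolynomial hV hφ, hfq, sub_self]

end FiniteRankOperator

open FiniteRankOperator

/-! ### Unisolvence of the node functionals -/

theorem degree_legendre (k : ℕ) : (legendre k).degree = k := by
  rw [legendre, degree_C_mul (by simp), degree_map_eq_of_injective Int.cast_injective,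
    degree_shiftedLegendre]

/-- The Legendre polynomials, one in each degree. -/
def legendreSequence : Polynomial.Sequence ℝ := ⟨legendre, degree_legendre⟩

theorem legendre_zero : legendre 0 = 1 := by
  simp [legendre, shiftedLegendre]

theorem span_legendre (k : ℕ) : Submodule.span ℝ (legendre '' Iio k) = degreeLT ℝ k :=
  legendreSequence.span_degreeLT fun i _ => by simp

theorem moment_onPolynomial_comm (p q : ℝ[X]) :
    (moment p).onPolynomial q = (moment q).onPolynomial p := by
  simp only [onPolynomial_apply, moment_apply, mul_comm]

theorem moment_eq_zero_of_legendre {k : ℕ} {p : ℝ[X]}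
    (h : ∀ i < k, (moment (legendre i)).onPolynomial p = 0) {r : ℝ[X]} (hr : r ∈ degreeLT ℝ k) :
    (moment r).onPolynomial p = 0 := by
  rw [moment_onPolynomial_comm, ← LinearMap.mem_ker]
  rw [← span_legendre] at hr
  refine Submodule.span_le.2 ?_ hr
  rintro _ ⟨i, hi, rfl⟩
  exact (moment_onPolynomial_comm _ _).trans (h i hi)

theorem pow_dvd_of_derivatives_vanish {p : ℝ[X]} {t : ℝ} {k : ℕ}
    (h : ∀ i < k, (derivative^[i] p).eval t = 0) : (X - C t) ^ k ∣ p := by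
  rcases eq_or_ne p 0 with rfl | hp
  · exact dvd_zero _
  rcases k with _ | k
  · simp
  rw [← le_rootMultiplicity_iff hp]
  exact (lt_rootMultiplicity_iff_isRoot_iterate_derivative hp).2 fun i hi =>
    h i (Nat.lt_succ_of_le hi)

theorem exists_eq_bubble_mul_of_derivatives_vanish {p : ℝ[X]} {k : ℕ}
    (h₀ : ∀ i < k, (derivative^[i] p).eval 0 = 0) (h₁ : ∀ i < k, (derivative^[i] p).eval 1 = 0) :
    ∃ q, p = (X * (1 - X)) ^ k * q := by
  have hcoprime : IsCoprime (X - C (0 : ℝ)) (X - C 1) := isCoprime_X_sub_C_of_isUnit_sub (by simp)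
  obtain ⟨q, rfl⟩ := (hcoprime.pow (m := k) (n := k)).mul_dvd
    (pow_dvd_of_derivatives_vanish h₀) (pow_dvd_of_derivatives_vanish h₁)
  refine ⟨(-1) ^ k * q, ?_⟩
  simp only [← mul_assoc, ← mul_pow, map_zero, map_one]
  ring

theorem natDegree_bubble_mul (k : ℕ) {q : ℝ[X]} (hq : q ≠ 0) :
    ((X * (1 - X)) ^ k * q : ℝ[X]).natDegree = 2 * k + q.natDegree := by
  have hX : (X * (1 - X) : ℝ[X]).natDegree = 2 := by compute_degree!
  have hne : (X * (1 - X) : ℝ[X]) ≠ 0 := ne_zero_of_natDegree_gt (hX ▸ zero_lt_two)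
  rw [natDegree_mul (pow_ne_zero k hne) hq, natDegree_pow, hX, mul_comm]

theorem eq_zero_of_moment_bubble {k : ℕ} {q : ℝ[X]}
    (h : (moment q).onPolynomial ((X * (1 - X)) ^ k * q) = 0) : q = 0 := by
  have hformula (s : ℝ) : q.eval s * ((X * (1 - X)) ^ k * q).eval s
      = (s * (1 - s)) ^ k * q.eval s ^ 2 := by
    simp only [eval_mul, eval_pow, eval_sub, eval_X, eval_one]; ring
  rw [onPolynomial_apply, moment_apply] at h
  simp only [hformula] at h
  by_contra hq
  obtain ⟨t, ht, htq⟩ : ∃ t ∈ Ioo (0 : ℝ) 1, q.eval t ≠ 0 := by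
    by_contra! hroots
    exact hq (eq_zero_of_infinite_isRoot q ((Ioo_infinite zero_lt_one).mono hroots))
  refine (intervalIntegral.integral_pos zero_lt_one (by fun_prop) (fun s hs => ?_)
    ⟨t, Ioo_subset_Icc_self ht, ?_⟩).ne' h
  · exact mul_nonneg (pow_nonneg (mul_nonneg hs.1.le (sub_nonneg.2 hs.2)) k) (sq_nonneg _)
  · exact mul_pos (pow_pos (mul_pos ht.1 (sub_pos.2 ht.2)) k) (by positivity)

section Unisolvence

variable {m n : ℕ}

theorem unisolvent_nodeFunctional1 (hn : 2 * m + 1 ≤ n) :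
    Unisolvent (nodeFunctional1 m n) (degreeLE ℝ ((n - 1 : ℕ) : WithBot ℕ)) := by
  intro p hp h
  rw [mem_degreeLE, ← natDegree_le_iff_degree_le] at hp
  obtain ⟨q, rfl⟩ := exists_eq_bubble_mul_of_derivatives_vanish (p := p) (k := m)
    (fun i hi => by
      rw [← Icc.coe_zero, ← pointDeriv_onPolynomial,
        ← nodeFunctional1_left (n := n) hi (by omega)]
      exact h _)
    (fun i hi => by
      rw [← Icc.coe_one, ← pointDeriv_onPolynomial,
        ← nodeFunctional1_right (n := n) hi (by omega)]
      exact h _)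
  have hq : q ∈ degreeLT ℝ (n - 2 * m) := by
    rcases eq_or_ne q 0 with rfl | hq
    · exact zero_mem _
    rw [natDegree_bubble_mul m hq] at hp
    rw [mem_degreeLT, degree_eq_natDegree hq]
    exact_mod_cast (by omega)
  have horth : (moment q).onPolynomial ((X * (1 - X)) ^ m * q) = 0 :=
    moment_eq_zero_of_legendre (fun i hi => by
      rw [← nodeFunctional1_moment (m := m) (n := n) (by omega)]
      exact h _) hq
  rw [eq_zero_of_moment_bubble horth, mul_zero]

theorem unisolvent_nodeFunctional0 (hn : 2 * m + 1 ≤ n) :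
    Unisolvent (nodeFunctional0 m n) (degreeLE ℝ (n : WithBot ℕ)) := by
  intro p hp h
  have hderiv : derivative p = 0 := by
    refine unisolvent_nodeFunctional1 hn _ ?_ fun j => ?_
    · rw [mem_degreeLE, ← natDegree_le_iff_degree_le] at hp ⊢
      exact (natDegree_derivative_le p).trans (Nat.sub_le_sub_right hp 1)
    · rw [← compDeriv_onPolynomial, ← nodeFunctional0_castSucc]
      exact h _
  obtain ⟨κ, rfl⟩ : ∃ κ, p = C κ := ⟨_, eq_C_of_derivative_eq_zero hderiv⟩
  have hlast := h (Fin.last n)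
  rw [nodeFunctional0_last, onPolynomial_apply, endpointSum_apply, eval_C, eval_C] at hlast
  rw [show κ = 0 by linarith, C_0]

end Unisolvence

/-! ### The basis functions -/

theorem coeff_antideriv_succ (p : ℝ[X]) (k : ℕ) :
    (antideriv p).coeff (k + 1) = p.coeff k / ((k : ℝ) + 1) := by
  rw [antideriv, Polynomial.sum, finsetSum_coeff]
  simp only [coeff_monomial, Nat.add_right_cancel_iff]
  rw [Finset.sum_ite_eq' p.support k]
  split_ifs with h
  · rfl
  · rw [notMem_support_iff.1 h, zero_div]

theorem natDegree_antideriv {p : ℝ[X]} (hp : p ≠ 0) :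
    (antideriv p).natDegree = p.natDegree + 1 := by
  refine natDegree_eq_of_le_of_coeff_ne_zero (natDegree_le_iff_coeff_eq_zero.2 ?_) ?_
  · rintro (_ | k) hk
    · omega
    · rw [coeff_antideriv_succ, coeff_eq_zero_of_natDegree_lt (by omega), zero_div]
  · rw [coeff_antideriv_succ]
    exact div_ne_zero (by simpa using hp) (by positivity)

theorem integratedLegendre_ne_zero_and_natDegree (α j : ℕ) :
    integratedLegendre α j ≠ 0 ∧ (integratedLegendre α j).natDegree = j + α := by
  induction α with
  | zero => exact ⟨legendreSequence.ne_zero j, legendreSequence.natDegree_eq j⟩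
  | succ α ih =>
    rw [integratedLegendre, Function.iterate_succ_apply', ← integratedLegendre]
    have hdeg := natDegree_antideriv ih.1
    exact ⟨ne_zero_of_natDegree_gt (n := 0) (by omega), by rw [hdeg, ih.2, add_assoc]⟩

theorem natDegree_hermiteLeft_le {m β : ℕ} (hβ : β ≤ m) :
    (hermiteLeft m β).natDegree ≤ 2 * m + 1 := by
  have hsum : (∑ k ∈ Finset.range (m - β + 1), C ((m + k).choose m : ℝ) * X ^ k).natDegree
      ≤ m - β :=
    natDegree_sum_le_of_forall_le _ _ fun k hk =>
      (natDegree_C_mul_X_pow_le _ _).trans (Nat.lt_succ_iff.1 (Finset.mem_range.1 hk))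
  have hpow : ((1 - X : ℝ[X]) ^ (m + 1)).natDegree ≤ m + 1 := by compute_degree
  have hmon : (C ((β.factorial : ℝ)⁻¹) * X ^ β).natDegree ≤ β := natDegree_C_mul_X_pow_le _ _
  exact (natDegree_mul_le_of_le hmon (natDegree_mul_le_of_le hpow hsum)).trans (by omega)

theorem natDegree_hermiteRight_le {m β : ℕ} (hβ : β ≤ m) :
    (hermiteRight m β).natDegree ≤ 2 * m + 1 := by
  have hX : (1 - X : ℝ[X]).natDegree ≤ 1 := by compute_degree
  calc (hermiteRight m β).natDegree
      ≤ (hermiteLeft m β).natDegree * (1 - X : ℝ[X]).natDegree :=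
        (natDegree_C_mul_le _ _).trans natDegree_comp_le
    _ ≤ (2 * m + 1) * 1 := Nat.mul_le_mul (natDegree_hermiteLeft_le hβ) hX
    _ = 2 * m + 1 := mul_one _

theorem eq_zero_of_natDegree_sum_smul_le {ι : Type*} [Fintype ι] {φ : ι → ℝ[X]} {c : ι → ℝ}
    {d : ℕ} (hinj : InjOn (fun j => (φ j).natDegree) {j | d < (φ j).natDegree})
    (hsum : (∑ j, c j • φ j).natDegree ≤ d) {j : ι} (hj : d < (φ j).natDegree) : c j = 0 := by
  classical
  by_contra hc
  obtain ⟨i, hi, hmax⟩ := Finset.exists_max_image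
    (Finset.univ.filter fun i => c i ≠ 0 ∧ d < (φ i).natDegree)
    (fun i => (φ i).natDegree) ⟨j, by simp [hc, hj]⟩
  simp only [Finset.mem_filter, Finset.mem_univ, true_and] at hi hmax
  have hcoeff : (∑ l, c l • φ l).coeff (φ i).natDegree = 0 :=
    coeff_eq_zero_of_natDegree_lt (hsum.trans_lt hi.2)
  rw [finsetSum_coeff, Finset.sum_eq_single i _ (by simp), coeff_smul, smul_eq_mul,
    coeff_natDegree] at hcoeff
  · have hφ : φ i ≠ 0 := ne_zero_of_natDegree_gt hi.2
    exact mul_ne_zero hi.1 (leadingCoeff_ne_zero.2 hφ) hcoeff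
  · intro l _ hli
    rw [coeff_smul, smul_eq_mul]
    rcases lt_trichotomy (φ l).natDegree (φ i).natDegree with hlt | heq | hgt
    · rw [coeff_eq_zero_of_natDegree_lt hlt, mul_zero]
    · exact absurd (hinj (show d < _ from heq ▸ hi.2) hi.2 heq) hli
    · have hcl : c l = 0 := by_contra fun h => (hmax l ⟨h, hi.2.trans hgt⟩).not_gt hgt
      rw [hcl, zero_mul]

section Basis

variable {m n : ℕ}

theorem natDegree_basis0_hermite_le {j : Fin (n + 1)} (hj : (j : ℕ) ≤ 2 * m ∨ (j : ℕ) = n) :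
    (basis0 m n j).natDegree ≤ 2 * m + 1 := by
  have hl := natDegree_hermiteLeft_le m.zero_le
  have hr := natDegree_hermiteRight_le m.zero_le
  unfold basis0
  split_ifs
  · exact natDegree_hermiteLeft_le (by omega)
  · exact natDegree_hermiteRight_le (by omega)
  · exact (natDegree_C_mul_le _ _).trans (natDegree_add_le_of_degree_le hl hr)
  · exact (natDegree_C_mul_le _ _).trans
      ((natDegree_sub_le_of_le hr hl).trans_eq (max_self _))
  · omega

theorem natDegree_basis0_legendre {j : Fin (n + 1)} (hj : ¬((j : ℕ) ≤ 2 * m ∨ (j : ℕ) = n)) :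
    (basis0 m n j).natDegree = j + 1 := by
  rw [basis0, if_neg (by omega), if_neg (by omega), if_neg (by omega),
    (integratedLegendre_ne_zero_and_natDegree _ _).2]
  omega

theorem basis0_mem_degreeLE (hn : 2 * m + 1 ≤ n) (j : Fin (n + 1)) :
    basis0 m n j ∈ degreeLE ℝ (n : WithBot ℕ) := by
  rw [mem_degreeLE, ← natDegree_le_iff_degree_le]
  by_cases hj : (j : ℕ) ≤ 2 * m ∨ (j : ℕ) = n
  · exact (natDegree_basis0_hermite_le hj).trans hn
  · rw [natDegree_basis0_legendre hj]
    omega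

theorem basis1_mem_degreeLE (hn : 2 * m + 1 ≤ n) (j : Fin n) :
    basis1 m n j ∈ degreeLE ℝ ((n - 1 : ℕ) : WithBot ℕ) := by
  have h := basis0_mem_degreeLE hn j.castSucc
  rw [mem_degreeLE, ← natDegree_le_iff_degree_le] at h ⊢
  exact (natDegree_derivative_le _).trans (Nat.sub_le_sub_right h 1)

theorem nodeFunctional0_pointDeriv {i : Fin (n + 1)} (hi : (i : ℕ) < 2 * m) (hin : (i : ℕ) < n)
    (p : ℝ[X]) : (nodeFunctional0 m n i).onPolynomial p
      = (derivative^[i / 2 + 1] p).eval (if (i : ℕ) % 2 = 0 then 0 else 1) := by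
  obtain ⟨i, rfl⟩ : ∃ j, Fin.castSucc j = i := ⟨⟨i, hin⟩, rfl⟩
  rw [Fin.val_castSucc] at hi ⊢
  rw [nodeFunctional0_castSucc, compDeriv_onPolynomial, nodeFunctional1, if_pos hi,
    pointDeriv_onPolynomial, Function.iterate_succ_apply]
  simp only [apply_ite Subtype.val, Icc.coe_zero, Icc.coe_one]

theorem nodeFunctional0_mean (hn : 2 * m < n) {f : ℝ → ℝ} (hf : ContDiffOn ℝ ∞ f (Icc 0 1)) :
    nodeFunctional0 m n ⟨2 * m, by omega⟩ f = f 1 - f 0 := by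
  have hnode : nodeFunctional1 m n ⟨2 * m, hn⟩ = moment 1 :=
    legendre_zero ▸ nodeFunctional1_moment (i := 0) hn
  have h := nodeFunctional0_castSucc (m := m) ⟨2 * m, hn⟩
  rw [Fin.castSucc_mk] at h
  rw [h, compDeriv_apply, hnode, moment_one_derivWithin hf]

theorem nodeFunctional0_basis0_of_lt (hn : 2 * m + 1 ≤ n) {i j : Fin (n + 1)}
    (hi : (i : ℕ) < 2 * m) (hj : (j : ℕ) ≤ 2 * m ∨ (j : ℕ) = n) :
    (nodeFunctional0 m n i).onPolynomial (basis0 m n j) = if i = j then 1 else 0 := by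
  rw [nodeFunctional0_pointDeriv hi (by omega), basis0]
  simp only [Fin.ext_iff]
  split_ifs <;> first
    | omega
    | simp (disch := omega) only [hermiteLeft_at_zero, hermiteLeft_at_one, hermiteRight_at_zero,
        hermiteRight_at_one, iterate_derivative_C_mul, iterate_derivative_sub,
        iterate_map_add, eval_mul, eval_add, eval_sub, ite_eq_left_iff, ite_eq_right_iff,
        Nat.add_right_cancel_iff, reduceCtorEq, if_false, mul_zero, add_zero, sub_zero] <;> omega

theorem eval_basis0_of_lt {j : Fin (n + 1)} (hj : (j : ℕ) < 2 * m) :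
    (basis0 m n j).eval 0 = 0 ∧ (basis0 m n j).eval 1 = 0 := by
  have hl0 := hermiteLeft_at_zero m (j / 2 + 1) 0 (by omega) m.zero_le
  have hl1 := hermiteLeft_at_one m (j / 2 + 1) 0 m.zero_le
  have hr0 := hermiteRight_at_zero m (j / 2 + 1) 0 m.zero_le
  have hr1 := hermiteRight_at_one m (j / 2 + 1) 0 (by omega) m.zero_le
  rw [basis0, if_pos hj]
  split_ifs
  exacts [⟨hl0, hl1⟩, ⟨hr0, hr1⟩]

theorem eval_basis0_two_mul {j : Fin (n + 1)} (hj : (j : ℕ) = 2 * m) (hjn : (j : ℕ) ≠ n) :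
    (basis0 m n j).eval 0 = -(1 / 2) ∧ (basis0 m n j).eval 1 = 1 / 2 := by
  have hl0 := hermiteLeft_at_zero m 0 0 m.zero_le m.zero_le
  have hl1 := hermiteLeft_at_one m 0 0 m.zero_le
  have hr0 := hermiteRight_at_zero m 0 0 m.zero_le
  have hr1 := hermiteRight_at_one m 0 0 m.zero_le m.zero_le
  rw [Function.iterate_zero_apply] at hl0 hl1 hr0 hr1
  rw [basis0, if_neg hj.not_lt, if_neg hjn, if_pos hj]
  simp [hl0, hl1, hr0, hr1]

theorem eval_basis0_last (hn : 2 * m ≤ n) :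
    (basis0 m n (Fin.last n)).eval 0 = 1 / 2 ∧ (basis0 m n (Fin.last n)).eval 1 = 1 / 2 := by
  have hl0 := hermiteLeft_at_zero m 0 0 m.zero_le m.zero_le
  have hl1 := hermiteLeft_at_one m 0 0 m.zero_le
  have hr0 := hermiteRight_at_zero m 0 0 m.zero_le
  have hr1 := hermiteRight_at_one m 0 0 m.zero_le m.zero_le
  rw [Function.iterate_zero_apply] at hl0 hl1 hr0 hr1
  rw [basis0, if_neg (by simpa using hn), if_pos (Fin.val_last n)]
  simp [hl0, hl1, hr0, hr1]

theorem nodeFunctional0_basis0_hermite (hn : 2 * m + 1 ≤ n) {i j : Fin (n + 1)}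
    (hi : (i : ℕ) ≤ 2 * m ∨ (i : ℕ) = n) (hj : (j : ℕ) ≤ 2 * m ∨ (j : ℕ) = n) :
    (nodeFunctional0 m n i).onPolynomial (basis0 m n j) = if i = j then 1 else 0 := by
  by_cases him : (i : ℕ) < 2 * m
  · exact nodeFunctional0_basis0_of_lt hn him hj
  obtain him | rfl : i = ⟨2 * m, by omega⟩ ∨ i = Fin.last n := by grind
  · rw [him, onPolynomial_apply, nodeFunctional0_mean hn (contDiff_eval _).contDiffOn]
    obtain hj | hj | rfl : (j : ℕ) < 2 * m ∨ (j : ℕ) = 2 * m ∨ j = Fin.last n := by grind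
    · rw [(eval_basis0_of_lt hj).1, (eval_basis0_of_lt hj).2, if_neg (by grind), sub_zero]
    · rw [(eval_basis0_two_mul hj (by omega)).1, (eval_basis0_two_mul hj (by omega)).2,
        if_pos (Fin.ext hj.symm)]
      norm_num
    · rw [(eval_basis0_last (by omega)).1, (eval_basis0_last (by omega)).2, if_neg (by grind),
        sub_self]
  · rw [onPolynomial_apply, nodeFunctional0_last, endpointSum_apply]
    obtain hj | hj | rfl : (j : ℕ) < 2 * m ∨ (j : ℕ) = 2 * m ∨ j = Fin.last n := by grind
    · rw [(eval_basis0_of_lt hj).1, (eval_basis0_of_lt hj).2, if_neg (by grind), add_zero]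
    · rw [(eval_basis0_two_mul hj (by omega)).1, (eval_basis0_two_mul hj (by omega)).2,
        if_neg (by grind), add_neg_cancel]
    · rw [(eval_basis0_last (by omega)).1, (eval_basis0_last (by omega)).2, if_pos rfl]
      norm_num

theorem eq_of_sum_smul_basis0_eq_C (hn : 2 * m + 1 ≤ n) {c : Fin (n + 1) → ℝ} {κ : ℝ}
    (hc : ∑ j, c j • basis0 m n j = C κ) (i : Fin (n + 1)) :
    c i = (nodeFunctional0 m n i).onPolynomial (C κ) := by
  have hlegendre (j : Fin (n + 1)) (hj : ¬((j : ℕ) ≤ 2 * m ∨ (j : ℕ) = n)) : c j = 0 := by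
    refine eq_zero_of_natDegree_sum_smul_le (d := 2 * m + 1) (fun k hk l hl hkl => ?_)
      (hc ▸ (natDegree_C κ).trans_le (Nat.zero_le _))
      (by rw [natDegree_basis0_legendre hj]; omega)
    have hk' := fun h => (natDegree_basis0_hermite_le h).not_gt (mem_ofPred_eq ▸ hk)
    have hl' := fun h => (natDegree_basis0_hermite_le h).not_gt (mem_ofPred_eq ▸ hl)
    simp only [natDegree_basis0_legendre hk', natDegree_basis0_legendre hl'] at hkl
    exact Fin.ext (Nat.succ_injective hkl)
  by_cases hi : (i : ℕ) ≤ 2 * m ∨ (i : ℕ) = n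
  · rw [← hc, map_sum, Finset.sum_eq_single i _ (by simp), map_smul,
      nodeFunctional0_basis0_hermite hn hi hi, if_pos rfl, smul_eq_mul, mul_one]
    intro j _ hji
    rw [map_smul, smul_eq_mul]
    by_cases hj : (j : ℕ) ≤ 2 * m ∨ (j : ℕ) = n
    · rw [nodeFunctional0_basis0_hermite hn hi hj, if_neg hji.symm, mul_zero]
    · rw [hlegendre j hj, zero_mul]
  · obtain ⟨i, rfl⟩ : ∃ j, Fin.castSucc j = i := ⟨⟨i, by omega⟩, rfl⟩
    rw [hlegendre _ hi, nodeFunctional0_castSucc, compDeriv_onPolynomial, derivative_C, map_zero]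

theorem linearIndependent_basis0 (hn : 2 * m + 1 ≤ n) : LinearIndependent ℝ (basis0 m n) := by
  refine Fintype.linearIndependent_iff.2 fun c hc i => ?_
  rw [← C_0] at hc
  rw [eq_of_sum_smul_basis0_eq_C hn hc, C_0, map_zero]

theorem linearIndependent_basis1 (hn : 2 * m + 1 ≤ n) : LinearIndependent ℝ (basis1 m n) := by
  refine Fintype.linearIndependent_iff.2 fun c hc i => ?_
  have hderiv : derivative (∑ j, c j • basis0 m n (Fin.castSucc j)) = 0 := by
    simpa only [map_sum, map_smul, basis1] using hc
  have hsnoc : ∑ j, (Fin.snoc c 0 : Fin (n + 1) → ℝ) j • basis0 m n j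
      = C ((∑ j, c j • basis0 m n (Fin.castSucc j)).coeff 0) := by
    rw [← eq_C_of_derivative_eq_zero hderiv, Fin.sum_univ_castSucc]
    simp only [Fin.snoc_castSucc, Fin.snoc_last, zero_smul, add_zero]
  have hi := eq_of_sum_smul_basis0_eq_C hn hsnoc i.castSucc
  rwa [Fin.snoc_castSucc, nodeFunctional0_castSucc, compDeriv_onPolynomial, derivative_C,
    map_zero] at hi

end Basis

/-! ### Sequences of derivatives -/

/-- The functions `u a` are the successive derivatives of `u 0` on `[0, 1]`. -/
def IsDerivSeq (u : ℕ → ℝ → ℝ) : Prop :=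
  ∀ a, ∀ t ∈ Icc (0 : ℝ) 1, HasDerivWithinAt (u a) (u (a + 1) t) (Icc 0 1) t

namespace IsDerivSeq

variable {u : ℕ → ℝ → ℝ}

theorem iteratedDerivWithin_eqOn (hu : IsDerivSeq u) (a : ℕ) :
    EqOn (iteratedDerivWithin a (u 0) (Icc 0 1)) (u a) (Icc 0 1) := by
  induction a with
  | zero => exact fun t _ => congrFun iteratedDerivWithin_zero t
  | succ a ih =>
    intro t ht
    rw [iteratedDerivWithin_succ, derivWithin_congr ih (ih ht)]
    exact (hu a t ht).derivWithin (uniqueDiffOn_Icc zero_lt_one t ht)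

theorem derivWithin_eqOn (hu : IsDerivSeq u) :
    EqOn (derivWithin (u 0) (Icc 0 1)) (u 1) (Icc 0 1) := fun t ht =>
  (hu 0 t ht).derivWithin (uniqueDiffOn_Icc zero_lt_one t ht)

theorem contDiffOn (hu : IsDerivSeq u) : ContDiffOn ℝ ∞ (u 0) (Icc 0 1) :=
  contDiffOn_of_differentiableOn_deriv fun a _ t ht =>
    (hu a t ht).differentiableWithinAt.congr (hu.iteratedDerivWithin_eqOn a)
      (hu.iteratedDerivWithin_eqOn a ht)

theorem sum_mul_const {ι : Type*} [Fintype ι] {v : ι → ℕ → ℝ → ℝ} (hv : ∀ i, IsDerivSeq (v i))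
    (c : ι → ℝ) : IsDerivSeq fun a t => ∑ i, v i a t * c i := fun a t ht =>
  HasDerivWithinAt.fun_sum fun i _ => (hv i a t ht).mul_const (c i)

end IsDerivSeq

theorem isDerivSeq_eval_iterate_derivative (p : ℝ[X]) :
    IsDerivSeq fun a t => (derivative^[a] p).eval t := fun a t _ => by
  simp only [Function.iterate_succ_apply']
  exact (Polynomial.hasDerivAt _ t).hasDerivWithinAt

theorem MomentFunctional.apply_isDerivSeq (F : MomentFunctional) {u : ℕ → ℝ → ℝ}
    (hu : IsDerivSeq u) : F (u 0) = ∫ t, F.weight.eval t * u F.order t ∂F.measure :=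
  integral_congr_ae (F.ae_mem.mono fun t ht => by
    simp only [hu.iteratedDerivWithin_eqOn _ ht])

theorem MomentFunctional.apply_sum_mul_const (F : MomentFunctional) {ι : Type*} [Fintype ι]
    {v : ι → ℕ → ℝ → ℝ} (hv : ∀ i, IsDerivSeq (v i)) (c : ι → ℝ) :
    F (fun t => ∑ i, v i 0 t * c i) = ∑ i, F (v i 0) * c i := by
  rw [F.apply_isDerivSeq (IsDerivSeq.sum_mul_const hv c)]
  simp only [Finset.mul_sum, ← mul_assoc, F.apply_isDerivSeq (hv _), ← integral_mul_const]
  refine integral_finsetSum _ fun i _ => ((F.integrable (hv i).contDiffOn).congr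
    (F.ae_mem.mono fun t ht => ?_)).mul_const _
  simp only [(hv i).iteratedDerivWithin_eqOn _ ht]

/-! ### One-dimensional interpolation -/

/-- The one-dimensional interpolation operators, with the node functionals and basis functions kept
as data. -/
def element (m n : ℕ) (k : Fin 2) : FiniteRankOperator :=
  if k = 0 then ofBasis (nodeFunctional0 m n) (basis0 m n)
  else ofBasis (nodeFunctional1 m n) (basis1 m n)

section Element

variable {m n : ℕ}

theorem interp_eq_op_element (hn : 2 * m ≤ n) (k : Fin 2) :
    interp m n k = (element m n k).op := by
  rw [interp, element, apply_ite op, op_ofBasis, op_ofBasis,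
    funext₂ (node0_eq_nodeFunctional0 hn), funext₂ node1_eq_nodeFunctional1]

theorem shape_element_mem_degreeLE (hn : 2 * m + 1 ≤ n) (k : Fin 2) (j : (element m n k).Index) :
    (element m n k).shape j ∈ degreeLE ℝ ((n - (k : ℕ) : ℕ) : WithBot ℕ) := by
  fin_cases k
  · exact shape_ofBasis_mem (basis0_mem_degreeLE hn) j
  · exact shape_ofBasis_mem (basis1_mem_degreeLE hn) j

theorem op_element_eval (hn : 2 * m + 1 ≤ n) {k : Fin 2} {p : ℝ[X]}
    (hp : p ∈ degreeLE ℝ ((n - (k : ℕ) : ℕ) : WithBot ℕ)) :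
    (element m n k).op (fun t => p.eval t) = fun t => p.eval t := by
  suffices (element m n k).toPolynomial (fun t => p.eval t) = p from
    funext fun t => congrArg (eval t) this
  fin_cases k
  · exact (unisolvent_nodeFunctional0 hn).toPolynomial_eq (basis0_mem_degreeLE hn)
      (linearIndependent_basis0 hn) hp fun _ => rfl
  · exact (unisolvent_nodeFunctional1 hn).toPolynomial_eq (basis1_mem_degreeLE hn)
      (linearIndependent_basis1 hn) hp fun _ => rfl

theorem onPolynomial_toPolynomial_element0 (hn : 2 * m + 1 ≤ n) (f : ℝ → ℝ) (j : Fin (n + 1)) :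
    (nodeFunctional0 m n j).onPolynomial ((element m n 0).toPolynomial f)
      = nodeFunctional0 m n j f :=
  (unisolvent_nodeFunctional0 hn).onPolynomial_toPolynomial (basis0_mem_degreeLE hn)
    (linearIndependent_basis0 hn) f j

theorem onPolynomial_toPolynomial_element1 (hn : 2 * m + 1 ≤ n) (f : ℝ → ℝ) (j : Fin n) :
    (nodeFunctional1 m n j).onPolynomial ((element m n 1).toPolynomial f)
      = nodeFunctional1 m n j f :=
  (unisolvent_nodeFunctional1 hn).onPolynomial_toPolynomial (basis1_mem_degreeLE hn)
    (linearIndependent_basis1 hn) f j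

theorem toPolynomial_element_derivWithin (hn : 2 * m + 1 ≤ n) (f : ℝ → ℝ) :
    (element m n 1).toPolynomial (derivWithin f (Icc 0 1))
      = derivative ((element m n 0).toPolynomial f) := by
  refine (unisolvent_nodeFunctional1 hn).toPolynomial_eq (basis1_mem_degreeLE hn)
    (linearIndependent_basis1 hn) ?_ fun j => ?_
  · have h := toPolynomial_mem (shape_element_mem_degreeLE hn 0) f
    rw [mem_degreeLE, ← natDegree_le_iff_degree_le] at h ⊢
    exact (natDegree_derivative_le _).trans (Nat.sub_le_sub_right h 1)
  · rw [← compDeriv_onPolynomial, ← compDeriv_apply, ← nodeFunctional0_castSucc,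
      onPolynomial_toPolynomial_element0 hn]

theorem hasDerivAt_op_element (hn : 2 * m + 1 ≤ n) (f : ℝ → ℝ) (x : ℝ) :
    HasDerivAt ((element m n 0).op f) ((element m n 1).op (derivWithin f (Icc 0 1)) x) x := by
  unfold op
  rw [toPolynomial_element_derivWithin hn]
  exact Polynomial.hasDerivAt _ x

theorem eval_iterate_derivative_element1 (hn : 2 * m + 1 ≤ n) {γ : ℕ} (hγ : γ < m) {a : ℝ}
    (ha : a = 0 ∨ a = 1) (f : ℝ → ℝ) :
    (derivative^[γ] ((element m n 1).toPolynomial f)).eval a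
      = iteratedDerivWithin γ f (Icc 0 1) a := by
  rcases ha with rfl | rfl
  · have h := onPolynomial_toPolynomial_element1 hn f ⟨2 * γ, by omega⟩
    rwa [nodeFunctional1_left hγ, pointDeriv_onPolynomial, pointDeriv_apply] at h
  · have h := onPolynomial_toPolynomial_element1 hn f ⟨2 * γ + 1, by omega⟩
    rwa [nodeFunctional1_right hγ, pointDeriv_onPolynomial, pointDeriv_apply] at h

-- The values at the end points are recovered from the mean of `f'` and from `f 1 + f 0`.
theorem op_element0_endpoint (hn : 2 * m + 1 ≤ n) {f : ℝ → ℝ} (hf : ContDiffOn ℝ ∞ f (Icc 0 1))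
    {a : ℝ} (ha : a = 0 ∨ a = 1) : (element m n 0).op f a = f a := by
  have hmean := onPolynomial_toPolynomial_element0 hn f ⟨2 * m, by omega⟩
  have hsum := onPolynomial_toPolynomial_element0 hn f (Fin.last n)
  rw [onPolynomial_apply, nodeFunctional0_mean hn (contDiff_eval _).contDiffOn,
    nodeFunctional0_mean hn hf] at hmean
  rw [onPolynomial_apply, nodeFunctional0_last, endpointSum_apply, endpointSum_apply] at hsum
  unfold op
  rcases ha with rfl | rfl <;> linarith

theorem iteratedDerivWithin_op_element (hn : 2 * m + 1 ≤ n) {k : Fin 2} {γ : ℕ}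
    (hγ : γ + (k : ℕ) ≤ m) {f : ℝ → ℝ} (hf : ContDiffOn ℝ ∞ f (Icc 0 1)) {a : ℝ}
    (ha : a = 0 ∨ a = 1) :
    iteratedDerivWithin γ ((element m n k).op f) (Icc 0 1) a
      = iteratedDerivWithin γ f (Icc 0 1) a := by
  have haI : a ∈ Icc (0 : ℝ) 1 := by rcases ha with rfl | rfl <;> simp
  have hop (k : Fin 2) (γ : ℕ) : iteratedDerivWithin γ ((element m n k).op f) (Icc 0 1) a
      = (derivative^[γ] ((element m n k).toPolynomial f)).eval a :=
    (isDerivSeq_eval_iterate_derivative _).iteratedDerivWithin_eqOn γ haI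
  fin_cases k
  · cases γ with
    | zero =>
      rw [iteratedDerivWithin_zero, iteratedDerivWithin_zero]
      exact op_element0_endpoint hn hf ha
    | succ γ =>
      rw [hop, iteratedDerivWithin_succ', Function.iterate_succ_apply]
      exact (toPolynomial_element_derivWithin hn f) ▸
        eval_iterate_derivative_element1 hn hγ ha (derivWithin f (Icc 0 1))
  · rw [hop]
    exact eval_iterate_derivative_element1 hn hγ ha f

end Element

/-! ### Jets on the cube -/

theorem mem_cube {N : ℕ} {x : Fin N → ℝ} : x ∈ cube N ↔ ∀ l, x l ∈ Icc (0 : ℝ) 1 := by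
  simp [cube, Pi.le_def, forall_and]

theorem isCompact_cube (N : ℕ) : IsCompact (cube N) := isCompact_Icc

theorem update_mem_cube {N : ℕ} {x : Fin N → ℝ} (hx : x ∈ cube N) (l : Fin N) {t : ℝ}
    (ht : t ∈ Icc (0 : ℝ) 1) : Function.update x l t ∈ cube N :=
  mem_cube.2 <| (Function.forall_update_iff x fun _ s => s ∈ Icc (0 : ℝ) 1).2
    ⟨ht, fun q _ => mem_cube.1 hx q⟩

theorem insertNth_mem_cube {N : ℕ} {l : Fin (N + 1)} {t : ℝ} {y : Fin N → ℝ}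
    (ht : t ∈ Icc (0 : ℝ) 1) (hy : y ∈ cube N) :
    (l.insertNth t y : Fin (N + 1) → ℝ) ∈ cube (N + 1) := by
  rw [mem_cube] at hy ⊢
  rw [Fin.forall_iff_succAbove l]
  simpa using ⟨ht, hy⟩

/-- A family of functions on the cube, indexed by multi-indices, that are the successive partial
derivatives of the first one. -/
structure IsJet {N : ℕ} (D : (Fin N → ℕ) → (Fin N → ℝ) → ℝ) : Prop where
  continuousOn : ∀ α, ContinuousOn (D α) (cube N)
  hasDerivWithinAt : ∀ α l, ∀ x ∈ cube N, HasDerivWithinAt (fun t => D α (Function.update x l t))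
    (D (α + Pi.single l 1) x) (Icc 0 1) (x l)

/-- The restriction of a jet to the slice `x_l = t` of the cube, after `a` differentiations in the
direction normal to the slice. -/
def faceJet {N : ℕ} (D : (Fin (N + 1) → ℕ) → (Fin (N + 1) → ℝ) → ℝ) (l : Fin (N + 1)) (a : ℕ)
    (t : ℝ) (β : Fin N → ℕ) (y : Fin N → ℝ) : ℝ := D (l.insertNth a β) (l.insertNth t y)

section Jet

variable {N : ℕ}

theorem faceJet_zero_zero (D : (Fin (N + 1) → ℕ) → (Fin (N + 1) → ℝ) → ℝ) (l : Fin (N + 1))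
    (t : ℝ) (y : Fin N → ℝ) : faceJet D l 0 t 0 y = D 0 (l.insertNth t y) := by
  rw [faceJet, Fin.insertNth_zero_right, Pi.single_zero]

theorem insertNth_add_single_succAbove (l : Fin (N + 1)) (q : Fin N) (a : ℕ)
    (β : Fin N → ℕ) : (l.insertNth a (β + Pi.single q 1) : Fin (N + 1) → ℕ)
      = l.insertNth a β + Pi.single (l.succAbove q) 1 := by
  refine Fin.insertNth_eq_iff.2 ⟨by simp, ?_⟩
  funext i
  simp [Fin.removeNth, Pi.single_apply]

theorem insertNth_add_single_same (l : Fin (N + 1)) (a : ℕ) (β : Fin N → ℕ) :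
    (l.insertNth (a + 1) β : Fin (N + 1) → ℕ) = l.insertNth a β + Pi.single l 1 := by
  refine Fin.insertNth_eq_iff.2 ⟨by simp, ?_⟩
  funext i
  simp [Fin.removeNth]

theorem IsJet.face {D : (Fin (N + 1) → ℕ) → (Fin (N + 1) → ℝ) → ℝ} (hD : IsJet D)
    (l : Fin (N + 1)) (a : ℕ) {t : ℝ} (ht : t ∈ Icc (0 : ℝ) 1) : IsJet (faceJet D l a t) where
  continuousOn β := by
    refine (hD.continuousOn _).comp (Continuous.continuousOn ?_) fun y hy =>
      insertNth_mem_cube ht hy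
    exact continuous_const.finInsertNth l continuous_id
  hasDerivWithinAt β q y hy := by
    have h := hD.hasDerivWithinAt (l.insertNth a β) (l.succAbove q) _
      (insertNth_mem_cube (l := l) ht hy)
    simp only [Fin.insertNth_apply_succAbove, ← Fin.insertNth_update,
      ← insertNth_add_single_succAbove] at h
    exact h

theorem IsJet.isDerivSeq_faceJet {D : (Fin (N + 1) → ℕ) → (Fin (N + 1) → ℝ) → ℝ}
    (hD : IsJet D) (l : Fin (N + 1)) (β : Fin N → ℕ) {y : Fin N → ℝ} (hy : y ∈ cube N) :
    IsDerivSeq fun a t => faceJet D l a t β y := by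
  intro a t ht
  have h := hD.hasDerivWithinAt (l.insertNth a β) l _ (insertNth_mem_cube (l := l) ht hy)
  simp only [Fin.insertNth_apply_same, Fin.update_insertNth, ← insertNth_add_single_same] at h
  exact h

variable {D : (Fin N → ℕ) → (Fin N → ℝ) → ℝ}

theorem isJet_sum_smul {ι : Type*} [Fintype ι] (c : ι → ℝ)
    {D : ι → (Fin N → ℕ) → (Fin N → ℝ) → ℝ} (hD : ∀ i, IsJet (D i)) :
    IsJet fun α x => ∑ i, c i * D i α x where
  continuousOn α := continuousOn_finsetSum _ fun i _ => ((hD i).continuousOn α).const_mul (c i)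
  hasDerivWithinAt α l x hx := HasDerivWithinAt.fun_sum fun i _ =>
    ((hD i).hasDerivWithinAt α l x hx).const_mul (c i)

theorem IsJet.shift (hD : IsJet D) (β : Fin N → ℕ) : IsJet fun α => D (α + β) where
  continuousOn α := hD.continuousOn _
  hasDerivWithinAt α l x hx := by
    rw [add_right_comm]
    exact hD.hasDerivWithinAt (α + β) l x hx

theorem IsJet.isDerivSeq_update (hD : IsJet D) (l : Fin N) {x : Fin N → ℝ} (hx : x ∈ cube N) :
    IsDerivSeq fun a t => D (Pi.single l a) (Function.update x l t) := by
  intro a t ht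
  have h := hD.hasDerivWithinAt (Pi.single l a) l _ (update_mem_cube hx l ht)
  simpa only [Function.update_idem, Function.update_self, ← Pi.single_add] using h

theorem IsJet.partialDeriv_eqOn (hD : IsJet D) (l : Fin N) (γ : ℕ) :
    EqOn (partialDeriv l γ (D 0)) (D (Pi.single l γ)) (cube N) := by
  intro x hx
  have h := (hD.isDerivSeq_update l hx).iteratedDerivWithin_eqOn γ (mem_cube.1 hx l)
  simp only [Pi.single_zero, Function.update_eq_self] at h
  exact h

end Jet

/-! ### Tensor products of moment functionals -/

-- `hasDerivAt_integral_of_dominated_loc_of_deriv_le` needs a neighbourhood of the parameter, so it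
-- does not reach the end points of an interval.
theorem hasDerivWithinAt_integral_of_bounded {α : Type*} [MeasurableSpace α] {μ : Measure α}
    [IsFiniteMeasure μ] {F F' : ℝ → α → ℝ} {c : ℝ} {s : Set ℝ} (hs : Convex ℝ s)
    (hF : ∀ t ∈ s, Integrable (F t) μ)
    (hF' : ∀ᵐ y ∂μ, ∀ t ∈ s, HasDerivWithinAt (fun r => F r y) (F' t y) s t ∧ ‖F' t y‖ ≤ c)
    {t : ℝ} (ht : t ∈ s) :
    HasDerivWithinAt (fun r => ∫ y, F r y ∂μ) (∫ y, F' t y ∂μ) s t := by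
  rw [hasDerivWithinAt_iff_tendsto_slope]
  have hslope : ∀ r ∈ s, slope (fun r => ∫ y, F r y ∂μ) t r
      = ∫ y, slope (fun r => F r y) t r ∂μ := by
    intro r hr
    simp only [slope_def_module]
    rw [integral_smul, integral_sub (hF r hr) (hF t ht)]
  have hmem : ∀ᶠ r in nhdsWithin t (s \ {t}), r ∈ s \ {t} := self_mem_nhdsWithin
  refine Filter.Tendsto.congr' (f₁ := fun r => ∫ y, slope (fun r => F r y) t r ∂μ) ?_ ?_
  · filter_upwards [hmem] with r hr using (hslope r hr.1).symm
  · refine tendsto_integral_filter_of_dominated_convergence (fun _ => c) ?_ ?_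
      (integrable_const c) ?_
    · filter_upwards [hmem] with r hr
      simp only [slope_def_module]
      exact (((hF r hr.1).sub (hF t ht)).smul (r - t)⁻¹).aestronglyMeasurable
    · filter_upwards [hmem] with r hr
      filter_upwards [hF'] with y hy
      have h := hs.norm_image_sub_le_of_norm_hasDerivWithin_le (fun r hr => (hy r hr).1)
        (fun r hr => (hy r hr).2) ht hr.1
      have hpos : 0 < ‖r - t‖ := norm_pos_iff.2 (sub_ne_zero.2 hr.2)
      rw [slope_def_module, norm_smul, norm_inv, inv_mul_le_iff₀ hpos, mul_comm]
      exact h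
    · filter_upwards [hF'] with y hy
      exact hasDerivWithinAt_iff_tendsto_slope.1 (hy t ht).1

/-- The tensor product `F_1 ⊗ ⋯ ⊗ F_N` of moment functionals, as a functional on jets. -/
def tensorMoment {N : ℕ} (F : Fin N → MomentFunctional) (D : (Fin N → ℕ) → (Fin N → ℝ) → ℝ) : ℝ :=
  ∫ y, (∏ l, (F l).weight.eval (y l)) * D (fun l => (F l).order) y
    ∂Measure.pi fun l => (F l).measure

section TensorMoment

variable {N : ℕ}

theorem ae_pi_measure_mem_cube (F : Fin N → MomentFunctional) :
    ∀ᵐ y ∂Measure.pi fun l => (F l).measure, y ∈ cube N := by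
  simp only [mem_cube]
  exact ae_all_iff.2 fun l => Measure.tendsto_eval_ae_ae.eventually (F l).ae_mem

theorem continuous_prod_weight (F : Fin N → MomentFunctional) :
    Continuous fun y : Fin N → ℝ => ∏ l, (F l).weight.eval (y l) :=
  continuous_finsetProd _ fun l _ => (Polynomial.continuous _).comp (continuous_apply l)

theorem integrable_prod_weight_mul (F : Fin N → MomentFunctional) {g : (Fin N → ℝ) → ℝ}
    (hg : ContinuousOn g (cube N)) :
    Integrable (fun y => (∏ l, (F l).weight.eval (y l)) * g y)
      (Measure.pi fun l => (F l).measure) :=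
  integrable_of_continuousOn_of_ae_mem (isCompact_cube N) (ae_pi_measure_mem_cube F)
    ((continuous_prod_weight F).continuousOn.mul hg)

theorem tensorMoment_sum_smul (F : Fin N → MomentFunctional) {ι : Type*} [Fintype ι] (c : ι → ℝ)
    {D : ι → (Fin N → ℕ) → (Fin N → ℝ) → ℝ} (hD : ∀ i, IsJet (D i)) :
    tensorMoment F (fun α x => ∑ i, c i * D i α x) = ∑ i, c i * tensorMoment F (D i) := by
  simp only [tensorMoment, Finset.mul_sum, mul_left_comm _ (c _), ← integral_const_mul]
  exact integral_finsetSum _ fun i _ =>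
    (integrable_prod_weight_mul F ((hD i).continuousOn _)).const_mul (c i)

theorem IsJet.exists_norm_mul_faceJet_le {D : (Fin (N + 1) → ℕ) → (Fin (N + 1) → ℝ) → ℝ}
    (hD : IsJet D) (l : Fin (N + 1)) (a : ℕ) (β : Fin N → ℕ) {w : (Fin N → ℝ) → ℝ}
    (hw : Continuous w) :
    ∃ c, ∀ t ∈ Icc (0 : ℝ) 1, ∀ y ∈ cube N, ‖w y * faceJet D l a t β y‖ ≤ c := by
  have hcont : ContinuousOn (fun x : Fin (N + 1) → ℝ => w (l.removeNth x) * D (l.insertNth a β) x)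
      (cube (N + 1)) :=
    (hw.comp (continuous_pi fun i => continuous_apply _)).continuousOn.mul (hD.continuousOn _)
  obtain ⟨c, hc⟩ := (isCompact_cube (N + 1)).exists_bound_of_continuousOn hcont
  refine ⟨c, fun t ht y hy => ?_⟩
  simpa [faceJet] using hc _ (insertNth_mem_cube (l := l) ht hy)

theorem IsJet.isDerivSeq_tensorMoment {D : (Fin (N + 1) → ℕ) → (Fin (N + 1) → ℝ) → ℝ}
    (hD : IsJet D) (F : Fin N → MomentFunctional) (l : Fin (N + 1)) :
    IsDerivSeq fun a t => tensorMoment F (faceJet D l a t) := by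
  intro a t ht
  set β : Fin N → ℕ := fun l => (F l).order
  obtain ⟨c, hc⟩ := hD.exists_norm_mul_faceJet_le l (a + 1) β (continuous_prod_weight F)
  refine hasDerivWithinAt_integral_of_bounded (c := c)
    (F' := fun s y => (∏ l, (F l).weight.eval (y l)) * faceJet D l (a + 1) s β y)
    (convex_Icc 0 1)
    (fun s hs => integrable_prod_weight_mul F ((hD.face l a hs).continuousOn β)) ?_ ht
  filter_upwards [ae_pi_measure_mem_cube F] with y hy s hs
  exact ⟨(hD.isDerivSeq_faceJet l β hy a s hs).const_mul _, hc s hs y hy⟩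

theorem IsJet.tensorMoment_eq_apply {D : (Fin (N + 1) → ℕ) → (Fin (N + 1) → ℝ) → ℝ}
    (hD : IsJet D) (F : Fin (N + 1) → MomentFunctional) (l : Fin (N + 1)) :
    tensorMoment F D
      = F l fun t => tensorMoment (fun q => F (l.succAbove q)) (faceJet D l 0 t) := by
  have hmp := (measurePreserving_piFinSuccAbove (fun q => (F q).measure) l).symm
  have hint := integrable_prod_weight_mul F (hD.continuousOn fun q => (F q).order)
  have hord : (fun q => (F q).order)
      = l.insertNth (F l).order (fun q => (F (l.succAbove q)).order) :=
    (Fin.insertNth_self_removeNth l _).symm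
  rw [(F l).apply_isDerivSeq (hD.isDerivSeq_tensorMoment _ l)]
  rw [← hmp.integrable_comp_emb (MeasurableEquiv.measurableEmbedding _)] at hint
  rw [tensorMoment, ← hmp.integral_comp']
  refine (integral_prod _ hint).trans (integral_congr_ae (.of_forall fun t => ?_))
  simp only [Function.comp_apply, tensorMoment]
  rw [← integral_const_mul]
  refine integral_congr_ae (.of_forall fun y => ?_)
  simp only [MeasurableEquiv.piFinSuccAbove_symm_apply, Fin.insertNthEquiv, Equiv.coe_fn_mk]
  rw [Fin.prod_univ_succAbove _ l, hord]
  simp [faceJet, mul_assoc]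

end TensorMoment

/-! ### Tensor products of operators of finite rank -/

/-- The tensor product `T_1 ⊗ ⋯ ⊗ T_N` of operators of finite rank, as an operator on jets: unlike
in `tensorOp`, no variable is distinguished. -/
def tensorSum {N : ℕ} (T : Fin N → FiniteRankOperator) (D : (Fin N → ℕ) → (Fin N → ℝ) → ℝ)
    (x : Fin N → ℝ) : ℝ :=
  ∑ J : ∀ l, (T l).Index,
    tensorMoment (fun l => (T l).functional (J l)) D * ∏ l, ((T l).shape (J l)).eval (x l)

section TensorSum

variable {N : ℕ}

theorem contDiff_tensorSum (T : Fin N → FiniteRankOperator)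
    (D : (Fin N → ℕ) → (Fin N → ℝ) → ℝ) : ContDiff ℝ ∞ (tensorSum T D) :=
  ContDiff.sum fun J _ => contDiff_const.mul <| contDiff_prod fun l _ =>
    (contDiff_eval ((T l).shape (J l))).comp (contDiff_apply ℝ ℝ l)

theorem tensorSum_sum_smul (T : Fin N → FiniteRankOperator) {ι : Type*} [Fintype ι] (c : ι → ℝ)
    {D : ι → (Fin N → ℕ) → (Fin N → ℝ) → ℝ} (hD : ∀ i, IsJet (D i)) (x : Fin N → ℝ) :
    tensorSum T (fun α y => ∑ i, c i * D i α y) x = ∑ i, c i * tensorSum T (D i) x := by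
  simp only [tensorSum, tensorMoment_sum_smul _ c hD, Finset.sum_mul, Finset.mul_sum, mul_assoc]
  exact Finset.sum_comm

variable {D : (Fin (N + 1) → ℕ) → (Fin (N + 1) → ℝ) → ℝ}

theorem IsJet.isDerivSeq_tensorSum (hD : IsJet D) (T : Fin N → FiniteRankOperator)
    (l : Fin (N + 1)) (y : Fin N → ℝ) : IsDerivSeq fun a t => tensorSum T (faceJet D l a t) y :=
  IsDerivSeq.sum_mul_const (fun J : ∀ q, (T q).Index => hD.isDerivSeq_tensorMoment
    (fun q => (T q).functional (J q)) l) fun J => ∏ q, ((T q).shape (J q)).eval (y q)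

theorem IsJet.tensorSum_insertNth (hD : IsJet D) (T : Fin (N + 1) → FiniteRankOperator)
    (l : Fin (N + 1)) (s : ℝ) (y : Fin N → ℝ) :
    tensorSum T D (l.insertNth s y)
      = (T l).op (fun t => tensorSum (fun q => T (l.succAbove q)) (faceJet D l 0 t) y) s := by
  rw [tensorSum, ← (Fin.insertNthEquiv (fun q => (T q).Index) l).sum_comp, Fintype.sum_prod_type,
    op_apply]
  refine Finset.sum_congr rfl fun j _ => ?_
  have h := ((T l).functional j).apply_sum_mul_const
    (fun J : ∀ q, (T (l.succAbove q)).Index =>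
      hD.isDerivSeq_tensorMoment (fun q => (T (l.succAbove q)).functional (J q)) l)
    fun J => ∏ q, ((T (l.succAbove q)).shape (J q)).eval (y q)
  simp only [tensorSum]
  rw [h, Finset.sum_mul]
  refine Finset.sum_congr rfl fun J _ => ?_
  rw [hD.tensorMoment_eq_apply _ l, Fin.prod_univ_succAbove _ l]
  simp only [Fin.insertNthEquiv_apply, Fin.insertNth_apply_same, Fin.insertNth_apply_succAbove]
  ring

end TensorSum

section TensorOp

variable {N : ℕ} {D : (Fin N → ℕ) → (Fin N → ℝ) → ℝ}

theorem IsJet.tensorOp_eq_tensorSum (hD : IsJet D) {f : (Fin N → ℝ) → ℝ}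
    (hf : EqOn f (D 0) (cube N)) (T : Fin N → FiniteRankOperator) :
    tensorOp (fun l => (T l).op) f = tensorSum T D := by
  induction N with
  | zero =>
    funext x
    have hx : x ∈ cube 0 := mem_cube.2 fun l => l.elim0
    simp only [tensorOp, tensorSum, tensorMoment, Fintype.sum_unique, Finset.univ_eq_empty,
      Finset.prod_empty, one_mul, mul_one, Measure.pi_of_empty _ x, integral_dirac]
    rw [hf hx]
    congr 1
    exact Subsingleton.elim _ _
  | succ N ih =>
    funext x
    have hslice : EqOn (fun t => tensorOp (fun l => (T l.succ).op) (fun y => f (Fin.cons t y))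
        (Fin.tail x)) (fun t => tensorSum (fun l => T l.succ) (faceJet D 0 0 t) (Fin.tail x))
        (Icc 0 1) := by
      intro t ht
      refine congrFun (ih (hD.face 0 0 ht) (fun y hy => ?_) _) _
      rw [faceJet_zero_zero, Fin.insertNth_zero']
      exact hf (by simpa using insertNth_mem_cube (l := 0) ht hy)
    rw [tensorOp, (T 0).op_congr_of_eqOn hslice]
    conv_rhs => rw [← Fin.cons_self_tail x, ← Fin.insertNth_zero', hD.tensorSum_insertNth]
    rfl

theorem IsJet.tensorSum_congr {E : (Fin N → ℕ) → (Fin N → ℝ) → ℝ} (hD : IsJet D) (hE : IsJet E)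
    (h : EqOn (D 0) (E 0) (cube N)) (T : Fin N → FiniteRankOperator) :
    tensorSum T D = tensorSum T E := by
  rw [← hD.tensorOp_eq_tensorSum (fun _ _ => rfl), hE.tensorOp_eq_tensorSum h]

theorem IsJet.hasDerivAt_tensorSum_insertNth {D : (Fin (N + 1) → ℕ) → (Fin (N + 1) → ℝ) → ℝ}
    (hD : IsJet D) {T S : Fin (N + 1) → FiniteRankOperator} {l : Fin (N + 1)}
    (hTS : ∀ q, S (l.succAbove q) = T (l.succAbove q))
    (hl : ∀ g s, HasDerivAt ((T l).op g) ((S l).op (derivWithin g (Icc 0 1)) s) s)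
    (s : ℝ) (y : Fin N → ℝ) :
    HasDerivAt (fun t => tensorSum T D (l.insertNth t y))
      (tensorSum S (fun α => D (α + Pi.single l 1)) (l.insertNth s y)) s := by
  have hface (t : ℝ) : faceJet (fun α => D (α + Pi.single l 1)) l 0 t = faceJet D l 1 t := by
    funext β z
    simp only [faceJet, ← insertNth_add_single_same]
  rw [(hD.shift _).tensorSum_insertNth]
  simp only [hD.tensorSum_insertNth, hTS, hface]
  rw [← (S l).op_congr_of_eqOn (hD.isDerivSeq_tensorSum _ l y).derivWithin_eqOn]
  exact hl _ s

theorem IsJet.hasDerivAt_tensorSum (hD : IsJet D) {T S : Fin N → FiniteRankOperator} {l : Fin N}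
    (hTS : ∀ q ≠ l, S q = T q)
    (hl : ∀ g s, HasDerivAt ((T l).op g) ((S l).op (derivWithin g (Icc 0 1)) s) s)
    (x : Fin N → ℝ) :
    HasDerivAt (fun t => tensorSum T D (Function.update x l t))
      (tensorSum S (fun α => D (α + Pi.single l 1)) x) (x l) := by
  obtain _ | N := N
  · exact l.elim0
  have h := hD.hasDerivAt_tensorSum_insertNth (fun q => hTS _ (l.succAbove_ne q)) hl (x l)
    (l.removeNth x)
  simpa only [Fin.insertNth_removeNth, Function.update_eq_self] using h

theorem IsJet.partialDeriv_tensorSum {D : (Fin (N + 1) → ℕ) → (Fin (N + 1) → ℝ) → ℝ}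
    (hD : IsJet D) {T : Fin (N + 1) → FiniteRankOperator} {l : Fin (N + 1)} {γ : ℕ} {a : ℝ}
    (ha : a ∈ Icc (0 : ℝ) 1)
    (hl : ∀ g, ContDiffOn ℝ ∞ g (Icc 0 1) →
      iteratedDerivWithin γ ((T l).op g) (Icc 0 1) a = iteratedDerivWithin γ g (Icc 0 1) a)
    (y : Fin N → ℝ) :
    partialDeriv l γ (tensorSum T D) (l.insertNth a y)
      = tensorSum (fun q => T (l.succAbove q)) (faceJet D l γ a) y := by
  have hu := hD.isDerivSeq_tensorSum (fun q => T (l.succAbove q)) l y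
  simp only [partialDeriv, Fin.update_insertNth, Fin.insertNth_apply_same,
    hD.tensorSum_insertNth]
  exact (hl _ hu.contDiffOn).trans (hu.iteratedDerivWithin_eqOn γ ha)

-- The constant `c` absorbs the factors already processed in the induction.
theorem tensorOp_mul_prod_eval {A : Fin N → (ℝ → ℝ) → ℝ → ℝ} {V : Fin N → Submodule ℝ ℝ[X]}
    (hA : ∀ l, ∀ p ∈ V l, A l (fun t => p.eval t) = fun t => p.eval t) {p : Fin N → ℝ[X]}
    (hp : ∀ l, p l ∈ V l) (c : ℝ) (x : Fin N → ℝ) :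
    tensorOp A (fun y => c * ∏ l, (p l).eval (y l)) x = c * ∏ l, (p l).eval (x l) := by
  induction N generalizing c with
  | zero => rfl
  | succ N ih =>
    have hslice (t : ℝ) : tensorOp (fun l => A l.succ)
        (fun y => c * ∏ l, (p l).eval ((Fin.cons t y : Fin (N + 1) → ℝ) l)) (Fin.tail x)
        = ((c * ∏ l : Fin N, (p l.succ).eval (x l.succ)) • p 0).eval t := by
      simp only [Fin.prod_univ_succ, Fin.cons_zero, Fin.cons_succ, ← mul_assoc]
      rw [ih (fun l => hA l.succ) fun l => hp l.succ, eval_smul, smul_eq_mul, mul_right_comm]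
      rfl
    simp only [tensorOp, hslice]
    rw [hA 0 _ (Submodule.smul_mem _ _ (hp 0))]
    simp only [Fin.prod_univ_succ, eval_smul, smul_eq_mul]
    ring

end TensorOp

/-! ### Jets of smooth functions -/

/-- The partial derivative in the `l`-th variable of a function on the cube. -/
def dirDeriv {N : ℕ} (l : Fin N) (f : (Fin N → ℝ) → ℝ) (x : Fin N → ℝ) : ℝ :=
  fderivWithin ℝ f (cube N) x (Pi.single l 1)

section DirDeriv

variable {N : ℕ}

theorem convex_cube (N : ℕ) : Convex ℝ (cube N) := convex_Icc 0 1

theorem interior_cube_nonempty (N : ℕ) : (interior (cube N)).Nonempty :=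
  ⟨fun _ => 1 / 2, mem_interior_iff_mem_nhds.2
    (pi_Icc_mem_nhds (fun _ => by norm_num) (fun _ => by norm_num))⟩

theorem uniqueDiffOn_cube (N : ℕ) : UniqueDiffOn ℝ (cube N) :=
  uniqueDiffOn_convex (convex_cube N) (interior_cube_nonempty N)

variable {f : (Fin N → ℝ) → ℝ}

theorem hasDerivWithinAt_dirDeriv (hf : DifferentiableOn ℝ f (cube N)) (l : Fin N)
    {x : Fin N → ℝ} (hx : x ∈ cube N) :
    HasDerivWithinAt (fun t => f (Function.update x l t)) (dirDeriv l f x) (Icc 0 1) (x l) := by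
  have h := (hf x hx).hasFDerivWithinAt
  rw [← Function.update_eq_self l x] at h
  have := h.comp_hasDerivWithinAt (x l) (hasDerivAt_update x l (x l)).hasDerivWithinAt
    (s := Icc 0 1) fun t ht => update_mem_cube hx l ht
  rwa [Function.update_eq_self] at this

theorem dirDeriv_eq (hf : DifferentiableOn ℝ f (cube N)) {l : Fin N} {x : Fin N → ℝ}
    (hx : x ∈ cube N) {d : ℝ}
    (h : HasDerivWithinAt (fun t => f (Function.update x l t)) d (Icc 0 1) (x l)) :
    dirDeriv l f x = d :=
  (uniqueDiffOn_Icc zero_lt_one _ (mem_cube.1 hx l)).eq_deriv _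
    (hasDerivWithinAt_dirDeriv hf l hx) h

theorem dirDeriv_of_notMem {x : Fin N → ℝ} (hx : x ∉ cube N) (l : Fin N)
    (f : (Fin N → ℝ) → ℝ) : dirDeriv l f x = 0 := by
  rw [dirDeriv, fderivWithin_zero_of_notMem_closure
    (by rwa [(isCompact_cube N).isClosed.closure_eq]), zero_apply]

theorem contDiffOn_dirDeriv (hf : ContDiffOn ℝ ∞ f (cube N)) (l : Fin N) :
    ContDiffOn ℝ ∞ (dirDeriv l f) (cube N) :=
  (hf.fderivWithin (uniqueDiffOn_cube N) (m := ∞) (by simp)).clm_apply contDiffOn_const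

theorem dirDeriv_comm (hf : ContDiffOn ℝ ∞ f (cube N)) (l q : Fin N) :
    dirDeriv l (dirDeriv q f) = dirDeriv q (dirDeriv l f) := by
  funext x
  by_cases hx : x ∈ cube N
  swap
  · rw [dirDeriv_of_notMem hx, dirDeriv_of_notMem hx]
  have hu := uniqueDiffOn_cube N
  have hcl : x ∈ closure (interior (cube N)) := by
    rw [(convex_cube N).closure_interior_eq_closure_of_nonempty_interior (interior_cube_nonempty N)]
    exact subset_closure hx
  have hd : DifferentiableWithinAt ℝ (fderivWithin ℝ f (cube N)) (cube N) x :=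
    (hf.fderivWithin hu (m := ∞) (by simp)).differentiableOn (by simp) x hx
  have hsnd (i j : Fin N) : dirDeriv i (dirDeriv j f) x =
      fderivWithin ℝ (fderivWithin ℝ f (cube N)) (cube N) x (Pi.single i 1) (Pi.single j 1) := by
    unfold dirDeriv
    rw [fderivWithin_clm_apply (hu x hx) hd (differentiableWithinAt_const _)]
    simp
  rw [hsnd, hsnd]
  exact ((hf x hx).isSymmSndFDerivWithinAt
    (by simpa using WithTop.coe_le_coe.2 (le_top : (2 : ℕ∞) ≤ ⊤)) hu hcl hx).eq _ _

/-- The partial derivative in the `l`-th variable, acting on the smooth functions on the cube. -/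
def dirDerivEnd (l : Fin N) : Function.End {f : (Fin N → ℝ) → ℝ // ContDiffOn ℝ ∞ f (cube N)} :=
  fun f => ⟨dirDeriv l f.1, contDiffOn_dirDeriv f.2 l⟩

theorem commute_dirDerivEnd (l q : Fin N) : Commute (dirDerivEnd l) (dirDerivEnd q) :=
  funext fun f => Subtype.ext (dirDeriv_comm f.2 l q)

/-- The monomial `∂^α` in the partial derivatives, multiplicative in the multi-index `α`. -/
def multiDeriv : (Fin N → Multiplicative ℕ) →*
    Function.End {f : (Fin N → ℝ) → ℝ // ContDiffOn ℝ ∞ f (cube N)} :=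
  MonoidHom.noncommPiCoprod (fun l => powersHom _ (dirDerivEnd l))
    fun l q _ _ _ => (commute_dirDerivEnd l q).pow_pow _ _

theorem multiDeriv_mulSingle (l : Fin N) :
    multiDeriv (Pi.mulSingle l (Multiplicative.ofAdd 1)) = dirDerivEnd l :=
  (MonoidHom.noncommPiCoprod_mulSingle _ l _).trans (pow_one _)

theorem exists_isJet (hf : ContDiffOn ℝ ∞ f (cube N)) : ∃ D, IsJet D ∧ D 0 = f := by
  set D : (Fin N → ℕ) → {g : (Fin N → ℝ) → ℝ // ContDiffOn ℝ ∞ g (cube N)} := fun α =>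
    multiDeriv (fun l => Multiplicative.ofAdd (α l)) ⟨f, hf⟩ with hD
  have hadd (α : Fin N → ℕ) (l : Fin N) : (D (α + Pi.single l 1)).1 = dirDeriv l (D α).1 := by
    have hα : (fun q => Multiplicative.ofAdd ((α + Pi.single l 1 : Fin N → ℕ) q))
        = Pi.mulSingle l (Multiplicative.ofAdd 1) * fun q => Multiplicative.ofAdd (α q) := by
      funext q
      rcases eq_or_ne q l with rfl | hq
      · simp [mul_comm]
      · simp [hq]
    rw [hD]
    simp only [hα, map_mul, multiDeriv_mulSingle]
    rfl
  refine ⟨fun α => (D α).1, ⟨fun α => (D α).2.continuousOn, fun α l x hx => ?_⟩, ?_⟩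
  · rw [hadd]
    exact hasDerivWithinAt_dirDeriv ((D α).2.differentiableOn (by simp)) l hx
  · exact congrArg Subtype.val (congrFun (map_one multiDeriv) ⟨f, hf⟩)

theorem IsJet.dirDeriv_eqOn {D : (Fin N → ℕ) → (Fin N → ℝ) → ℝ} (hD : IsJet D)
    (hf : DifferentiableOn ℝ (D 0) (cube N)) (l : Fin N) :
    EqOn (dirDeriv l (D 0)) (D (Pi.single l 1)) (cube N) := fun x hx =>
  dirDeriv_eq hf hx (by simpa using hD.hasDerivWithinAt 0 l x hx)

end DirDeriv

section SmoothTensorOp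

variable {N : ℕ} (T : Fin N → FiniteRankOperator)

theorem tensorOp_congr {f g : (Fin N → ℝ) → ℝ} (hf : ContDiffOn ℝ ∞ f (cube N))
    (h : EqOn g f (cube N)) : tensorOp (fun l => (T l).op) g = tensorOp (fun l => (T l).op) f := by
  obtain ⟨D, hD, rfl⟩ := exists_isJet hf
  rw [hD.tensorOp_eq_tensorSum h, hD.tensorOp_eq_tensorSum fun _ _ => rfl]

theorem contDiff_tensorOp {f : (Fin N → ℝ) → ℝ} (hf : ContDiffOn ℝ ∞ f (cube N)) :
    ContDiff ℝ ∞ (tensorOp (fun l => (T l).op) f) := by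
  obtain ⟨D, hD, rfl⟩ := exists_isJet hf
  rw [hD.tensorOp_eq_tensorSum fun _ _ => rfl]
  exact contDiff_tensorSum T D

theorem tensorOp_sum_smul {ι : Type*} [Fintype ι] (c : ι → ℝ) {f : ι → (Fin N → ℝ) → ℝ}
    (hf : ∀ i, ContDiffOn ℝ ∞ (f i) (cube N)) (x : Fin N → ℝ) :
    tensorOp (fun l => (T l).op) (fun y => ∑ i, c i * f i y) x
      = ∑ i, c i * tensorOp (fun l => (T l).op) (f i) x := by
  choose D hD hD0 using fun i => exists_isJet (hf i)
  obtain rfl : (fun i => D i 0) = f := funext hD0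
  rw [(isJet_sum_smul c hD).tensorOp_eq_tensorSum fun _ _ => rfl, tensorSum_sum_smul T c hD]
  simp only [(hD _).tensorOp_eq_tensorSum fun _ _ => rfl]

variable {T}

theorem hasDerivAt_tensorOp {S : Fin N → FiniteRankOperator} {l : Fin N}
    (hTS : ∀ q ≠ l, S q = T q)
    (hl : ∀ g s, HasDerivAt ((T l).op g) ((S l).op (derivWithin g (Icc 0 1)) s) s)
    {f : (Fin N → ℝ) → ℝ} (hf : ContDiffOn ℝ ∞ f (cube N)) (x : Fin N → ℝ) :
    HasDerivAt (fun t => tensorOp (fun q => (T q).op) f (Function.update x l t))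
      (tensorOp (fun q => (S q).op) (dirDeriv l f) x) (x l) := by
  obtain ⟨D, hD, rfl⟩ := exists_isJet hf
  have hdir := hD.dirDeriv_eqOn (hf.differentiableOn (by simp)) l
  rw [hD.tensorOp_eq_tensorSum (fun _ _ => rfl), (hD.shift (Pi.single l 1)).tensorOp_eq_tensorSum
    (by rwa [zero_add])]
  exact hD.hasDerivAt_tensorSum hTS hl x

theorem partialDeriv_tensorOp_eq_of_partialDeriv_eq {l : Fin N} {γ : ℕ} {a b : ℝ}
    (ha : a ∈ Icc (0 : ℝ) 1) (hb : b ∈ Icc (0 : ℝ) 1)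
    (hl : ∀ s ∈ ({a, b} : Set ℝ), ∀ g, ContDiffOn ℝ ∞ g (Icc 0 1) →
      iteratedDerivWithin γ ((T l).op g) (Icc 0 1) s = iteratedDerivWithin γ g (Icc 0 1) s)
    {f g : (Fin N → ℝ) → ℝ} (hf : ContDiffOn ℝ ∞ f (cube N)) (hg : ContDiffOn ℝ ∞ g (cube N))
    (h : ∀ x ∈ cube N, partialDeriv l γ f (Function.update x l a)
      = partialDeriv l γ g (Function.update x l b)) (x : Fin N → ℝ) :
    partialDeriv l γ (tensorOp (fun q => (T q).op) f) (Function.update x l a)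
      = partialDeriv l γ (tensorOp (fun q => (T q).op) g) (Function.update x l b) := by
  obtain _ | N := N
  · exact l.elim0
  obtain ⟨D, hD, rfl⟩ := exists_isJet hf
  obtain ⟨E, hE, rfl⟩ := exists_isJet hg
  have htrace : EqOn (faceJet D l γ a 0) (faceJet E l γ b 0) (cube N) := by
    intro y hy
    have h' := h _ (insertNth_mem_cube (l := l) ha hy)
    rw [Fin.update_insertNth, Fin.update_insertNth,
      hD.partialDeriv_eqOn l γ (insertNth_mem_cube ha hy),
      hE.partialDeriv_eqOn l γ (insertNth_mem_cube hb hy)] at h'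
    simpa only [faceJet, Fin.insertNth_zero_right] using h'
  rw [hD.tensorOp_eq_tensorSum (fun _ _ => rfl), hE.tensorOp_eq_tensorSum (fun _ _ => rfl),
    ← Fin.insertNth_removeNth, ← Fin.insertNth_removeNth,
    hD.partialDeriv_tensorSum ha (hl a (by simp)), hE.partialDeriv_tensorSum hb (hl b (by simp)),
    (hD.face l γ ha).tensorSum_congr (hE.face l γ hb) htrace]

end SmoothTensorOp

/-! ### Coefficients of forms -/

namespace Chi

variable {N ν : ℕ}

theorem mem_support {i : Chi N ν} {l : Fin N} : l ∈ i.support ↔ i.1 l = 1 := by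
  simp [support]

theorem apply_eq_ite (i : Chi N ν) (l : Fin N) : i.1 l = if l ∈ i.support then 1 else 0 := by
  split_ifs with h
  · exact mem_support.1 h
  · rw [mem_support] at h
    omega

theorem dirs_mem_support (i : Chi N ν) (b : Fin ν) : i.dirs b ∈ i.support :=
  Finset.orderEmbOfFin_mem ..

theorem eq_of_forall_dirs_mem_support {i q : Chi N ν} (h : ∀ b, q.dirs b ∈ i.support) : i = q := by
  have hsub : q.support ⊆ i.support := by
    rw [← Finset.coe_subset, ← Finset.range_orderEmbOfFin q.support q.card_support]
    exact range_subset_iff.2 h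
  have hsupp := Finset.eq_of_subset_of_card_le hsub (by rw [i.card_support, q.card_support])
  exact Subtype.ext (funext fun l => by rw [apply_eq_ite, apply_eq_ite, hsupp])

theorem dirs_eq_of_strictMono (i : Chi N ν) {f : Fin ν → Fin N} (hf : ∀ b, f b ∈ i.support)
    (hmono : StrictMono f) : i.dirs = f :=
  (Finset.orderEmbOfFin_unique i.card_support hf hmono).symm

/-- The index whose support is a given set of `ν` variables. -/
def ofFinset (s : Finset (Fin N)) (hs : s.card = ν) : Chi N ν :=
  ⟨fun l => if l ∈ s then 1 else 0, by simp [apply_ite (fun k : Fin 2 => (k : ℕ)), hs]⟩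

theorem support_ofFinset (s : Finset (Fin N)) (hs : s.card = ν) : (ofFinset s hs).support = s := by
  ext l
  simp [mem_support, ofFinset]

/-- The index obtained from `i` by removing the `b`-th direction. -/
def erase (i : Chi N (ν + 1)) (b : Fin (ν + 1)) : Chi N ν :=
  ofFinset (i.support.erase (i.dirs b)) <| by
    rw [Finset.card_erase_of_mem (i.dirs_mem_support b), i.card_support, Nat.add_sub_cancel]

theorem erase_apply_dirs (i : Chi N (ν + 1)) (b : Fin (ν + 1)) : (i.erase b).1 (i.dirs b) = 0 := by
  rw [apply_eq_ite, erase, support_ofFinset, if_neg (Finset.notMem_erase _ _)]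

theorem erase_apply_of_ne (i : Chi N (ν + 1)) {b : Fin (ν + 1)} {q : Fin N} (hq : q ≠ i.dirs b) :
    (i.erase b).1 q = i.1 q := by
  rw [apply_eq_ite, apply_eq_ite i, erase, support_ofFinset]
  simp [hq]

theorem dirs_erase (i : Chi N (ν + 1)) (b : Fin (ν + 1)) :
    (i.erase b).dirs = i.dirs ∘ b.succAbove := by
  refine dirs_eq_of_strictMono _ (fun q => ?_) (i.dirs.strictMono.comp (Fin.strictMono_succAbove b))
  rw [erase, support_ofFinset, Finset.mem_erase]
  exact ⟨fun h => Fin.succAbove_ne b q (i.dirs.injective h), i.dirs_mem_support _⟩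

theorem exists_dirs_eq_comp_perm {v : Fin ν → Fin N} (hv : Function.Injective v) :
    ∃ (i : Chi N ν) (σ : Equiv.Perm (Fin ν)), i.dirs = v ∘ σ := by
  refine ⟨ofFinset (Finset.univ.image v) ?_, Tuple.sort v, dirs_eq_of_strictMono _ (fun b => ?_) ?_⟩
  · rw [Finset.card_image_of_injective _ hv, Finset.card_fin]
  · simp [support_ofFinset]
  · exact (Tuple.monotone_sort v).strictMono_of_injective (hv.comp (Tuple.sort v).injective)

theorem dx_single (i q : Chi N ν) :
    i.dx (fun b => Pi.single (q.dirs b) 1) = if i = q then 1 else 0 := by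
  change Matrix.det (Matrix.of fun a b => (Pi.single (q.dirs a) 1 : Fin N → ℝ) (i.dirs b)) = _
  split_ifs with h
  · subst h
    convert Matrix.det_one (R := ℝ) (n := Fin ν)
    ext a b
    simp [Matrix.one_apply, Pi.single_apply, eq_comm]
  · obtain ⟨a, ha⟩ : ∃ a, q.dirs a ∉ i.support := by
      by_contra! hall
      exact h (eq_of_forall_dirs_mem_support hall)
    refine Matrix.det_eq_zero_of_row_eq_zero a fun b => ?_
    rw [Matrix.of_apply, Pi.single_eq_of_ne]
    exact fun hab => ha (hab ▸ i.dirs_mem_support b)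

end Chi

theorem ext_apply_dirs {N ν : ℕ} {η₁ η₂ : (Fin N → ℝ) [⋀^Fin ν]→L[ℝ] ℝ}
    (h : ∀ i : Chi N ν, η₁ (fun b => Pi.single (i.dirs b) 1) = η₂ fun b => Pi.single (i.dirs b) 1) :
    η₁ = η₂ := by
  apply ContinuousAlternatingMap.toAlternatingMap_injective
  refine Module.Basis.ext_alternating (Pi.basisFun ℝ (Fin N)) fun v hv => ?_
  obtain ⟨i, σ, hi⟩ := Chi.exists_dirs_eq_comp_perm hv
  have hdirs : (fun b => (Pi.single (i.dirs b) 1 : Fin N → ℝ))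
      = (fun b => Pi.basisFun ℝ (Fin N) (v b)) ∘ σ := by
    funext b
    simp [hi]
  have hσ : η₁.toAlternatingMap ((fun b => Pi.basisFun ℝ (Fin N) (v b)) ∘ σ)
      = η₂.toAlternatingMap ((fun b => Pi.basisFun ℝ (Fin N) (v b)) ∘ σ) := hdirs ▸ h i
  rw [AlternatingMap.map_perm, AlternatingMap.map_perm] at hσ
  exact smul_left_cancel _ hσ

section Form

variable {N ν : ℕ}

theorem Form.coeff_sum_smul_dx (c : Chi N ν → (Fin N → ℝ) → ℝ) (i : Chi N ν) :
    Form.coeff (fun x => ∑ q, c q x • q.dx) i = c i := by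
  funext x
  simp [Form.coeff, ContinuousAlternatingMap.sum_apply, Chi.dx_single]

theorem Form.coeff_sum_smul {ι : Type*} [Fintype ι] (c : ι → ℝ) (u : ι → Form N ν)
    (i : Chi N ν) : (∑ j, c j • u j).coeff i = fun x => ∑ j, c j * (u j).coeff i x := by
  funext x
  simp [Form.coeff, ContinuousAlternatingMap.sum_apply]

variable {u : Form N ν}

theorem IsSmooth.coeff (hu : IsSmooth u) (i : Chi N ν) : ContDiffOn ℝ ∞ (u.coeff i) (cube N) :=
  (ContinuousAlternatingMap.apply ℝ (Fin N → ℝ) ℝ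
    fun b => Pi.single (i.dirs b) 1).contDiff.comp_contDiffOn hu

theorem isSmooth_dForm (hu : IsSmooth u) : IsSmooth (dForm u) := by
  have h : ContDiffOn ℝ ∞ (fderivWithin ℝ u (cube N)) (cube N) :=
    ContDiffOn.fderivWithin hu (uniqueDiffOn_cube N) (by simp)
  exact (ContinuousLinearMap.contDiff (𝕜 := ℝ)
    (E := (Fin N → ℝ) →L[ℝ] (Fin N → ℝ) [⋀^Fin ν]→L[ℝ] ℝ)
    (F := (Fin N → ℝ) [⋀^Fin (ν + 1)]→L[ℝ] ℝ)
    (ContinuousAlternatingMap.alternatizeUncurryFinCLM ℝ (Fin N → ℝ) ℝ)).comp_contDiffOn h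

theorem coeff_dForm (hu : IsSmooth u) (i : Chi N (ν + 1)) {x : Fin N → ℝ} (hx : x ∈ cube N) :
    (dForm u).coeff i x
      = ∑ b : Fin (ν + 1), (-1) ^ (b : ℕ) * dirDeriv (i.dirs b) (u.coeff (i.erase b)) x := by
  rw [Form.coeff, dForm, extDerivWithin_apply (hu.differentiableOn (by simp) x hx)
    (uniqueDiffOn_cube N x hx)]
  refine Finset.sum_congr rfl fun b _ => ?_
  have herase : u.coeff (i.erase b)
      = fun y => u y (b.removeNth fun q => (Pi.single (i.dirs q) 1 : Fin N → ℝ)) := by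
    funext y
    rw [Form.coeff, Chi.dirs_erase]
    rfl
  rw [herase, zsmul_eq_mul, dirDeriv]
  push_cast
  rfl

end Form

/-! ### The interpolation operators on forms -/

section Interpolation

variable {N ν m n : ℕ}

theorem tensorInterp_apply (hn : 2 * m ≤ n) (u : Form N ν) (x : Fin N → ℝ) :
    tensorInterp m n u x
      = ∑ i : Chi N ν, tensorOp (fun l => (element m n (i.1 l)).op) (u.coeff i) x • i.dx := by
  simp only [tensorInterp, interp_eq_op_element hn]

theorem coeff_tensorInterp (hn : 2 * m ≤ n) (u : Form N ν) (i : Chi N ν) :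
    (tensorInterp m n u).coeff i
      = tensorOp (fun l => (element m n (i.1 l)).op) (u.coeff i) := by
  rw [funext (tensorInterp_apply hn u), Form.coeff_sum_smul_dx]

theorem isSmooth_tensorInterp (hn : 2 * m ≤ n) {u : Form N ν} (hu : IsSmooth u) :
    IsSmooth (tensorInterp m n u) := by
  rw [funext (tensorInterp_apply hn u)]
  exact ContDiff.contDiffOn <| ContDiff.sum fun i _ =>
    (contDiff_tensorOp _ (hu.coeff i)).fun_smul contDiff_const

theorem tensorInterp_sum_smul (hn : 2 * m ≤ n) {ι : Type*} [Fintype ι] (c : ι → ℝ)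
    {u : ι → Form N ν} (hu : ∀ j, IsSmooth (u j)) :
    tensorInterp m n (∑ j, c j • u j) = ∑ j, c j • tensorInterp m n (u j) := by
  funext x
  refine ext_apply_dirs fun i => ?_
  change (tensorInterp m n (∑ j, c j • u j)).coeff i x
    = (∑ j, c j • tensorInterp m n (u j)).coeff i x
  simp only [coeff_tensorInterp hn, Form.coeff_sum_smul, tensorOp_sum_smul _ c fun j =>
    (hu j).coeff i]

theorem dirDeriv_coeff_tensorInterp (hn : 2 * m + 1 ≤ n) {u : Form N ν} (hu : IsSmooth u)
    (i : Chi N (ν + 1)) (b : Fin (ν + 1)) {x : Fin N → ℝ} (hx : x ∈ cube N) :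
    dirDeriv (i.dirs b) ((tensorInterp m n u).coeff (i.erase b)) x
      = tensorOp (fun l => (element m n (i.1 l)).op)
          (dirDeriv (i.dirs b) (u.coeff (i.erase b))) x := by
  have hsmooth := (isSmooth_tensorInterp (m := m) (n := n) (by omega) hu).coeff (i.erase b)
  refine dirDeriv_eq (hsmooth.differentiableOn (by simp)) hx ?_
  rw [coeff_tensorInterp (by omega)]
  refine (hasDerivAt_tensorOp (fun q hq => ?_) ?_ (hu.coeff _) x).hasDerivWithinAt
  · rw [i.erase_apply_of_ne hq]
  · rw [i.erase_apply_dirs, Chi.mem_support.1 (i.dirs_mem_support b)]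
    exact hasDerivAt_op_element hn

theorem tensorInterp_dForm (hn : 2 * m + 1 ≤ n) {u : Form N ν} (hu : IsSmooth u) :
    EqOn (tensorInterp m n (dForm u)) (dForm (tensorInterp m n u)) (cube N) := by
  intro x hx
  refine ext_apply_dirs fun i => ?_
  have hcoeff : EqOn (fun y => ∑ b : Fin (ν + 1),
      (-1) ^ (b : ℕ) * dirDeriv (i.dirs b) (u.coeff (i.erase b)) y) ((dForm u).coeff i)
      (cube N) := fun y hy => (coeff_dForm hu i hy).symm
  calc (tensorInterp m n (dForm u)).coeff i x
      = ∑ b : Fin (ν + 1), (-1) ^ (b : ℕ) * tensorOp (fun l => (element m n (i.1 l)).op)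
          (dirDeriv (i.dirs b) (u.coeff (i.erase b))) x := by
        rw [coeff_tensorInterp (by omega), ← tensorOp_congr _ ((isSmooth_dForm hu).coeff i) hcoeff]
        exact tensorOp_sum_smul _ _ (fun b => contDiffOn_dirDeriv (hu.coeff _) _) x
    _ = (dForm (tensorInterp m n u)).coeff i x := by
        rw [coeff_dForm (isSmooth_tensorInterp (by omega) hu) i hx]
        simp only [dirDeriv_coeff_tensorInterp hn hu i _ hx]

theorem tensorInterp_mem_tensorSpace (hn : 2 * m + 1 ≤ n) {u : Form N ν} (hu : IsSmooth u) :
    tensorInterp m n u ∈ tensorSpace n N ν := by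
  choose D hD hD0 using fun i => exists_isJet (hu.coeff i)
  have hsum : tensorInterp m n u = ∑ i : Chi N ν, ∑ J : ∀ l, (element m n (i.1 l)).Index,
      tensorMoment (fun l => (element m n (i.1 l)).functional (J l)) (D i) •
        rankOne i fun l => (element m n (i.1 l)).shape (J l) := by
    funext x
    rw [tensorInterp_apply (by omega)]
    simp only [Finset.sum_apply, Pi.smul_apply, rankOne, ← mul_smul, ← Finset.sum_smul, ← hD0,
      (hD _).tensorOp_eq_tensorSum fun _ _ => rfl, tensorSum]
  rw [hsum]
  exact Submodule.sum_mem _ fun i _ => Submodule.sum_mem _ fun J _ => Submodule.smul_mem _ _ <|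
    Submodule.subset_span ⟨i, _, fun l => shape_element_mem_degreeLE hn _ _, rfl⟩

theorem isSmooth_rankOne (i : Chi N ν) (p : Fin N → ℝ[X]) : IsSmooth (rankOne i p) :=
  ContDiff.contDiffOn <| (contDiff_prod fun l _ =>
    (contDiff_eval (p l)).comp (contDiff_apply ℝ ℝ l)).fun_smul contDiff_const

theorem coeff_rankOne (i q : Chi N ν) (p : Fin N → ℝ[X]) :
    (rankOne i p).coeff q = fun x => (if i = q then 1 else 0) * ∏ l, (p l).eval (x l) := by
  funext x
  simp [Form.coeff, rankOne, Chi.dx_single]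

theorem tensorInterp_rankOne (hn : 2 * m + 1 ≤ n) (i : Chi N ν) {p : Fin N → ℝ[X]}
    (hp : ∀ l, p l ∈ degreeLE ℝ ((n - (i.1 l : ℕ) : ℕ) : WithBot ℕ)) :
    tensorInterp m n (rankOne i p) = rankOne i p := by
  funext x
  refine ext_apply_dirs fun q => ?_
  change (tensorInterp m n (rankOne i p)).coeff q x = (rankOne i p).coeff q x
  rw [coeff_tensorInterp (by omega), coeff_rankOne]
  split_ifs with h
  · subst h
    exact tensorOp_mul_prod_eval (fun _ _ => op_element_eval hn) hp 1 x
  · simpa only [zero_mul] using tensorOp_mul_prod_eval (fun _ _ => op_element_eval hn) (p := 0)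
      (fun _ => zero_mem _) 0 x

theorem IsSmooth.of_mem_tensorSpace {w : Form N ν} (hw : w ∈ tensorSpace n N ν) : IsSmooth w := by
  induction hw using Submodule.span_induction with
  | mem w hw =>
    obtain ⟨i, p, -, rfl⟩ := hw
    exact isSmooth_rankOne i p
  | zero => exact contDiffOn_const
  | add _ _ _ _ hw hv => exact hw.add hv
  | smul c _ _ hw => exact hw.const_smul c

theorem tensorInterp_eq_self (hn : 2 * m + 1 ≤ n) {w : Form N ν} (hw : w ∈ tensorSpace n N ν) :
    tensorInterp m n w = w := by
  obtain ⟨k, c, g, rfl⟩ := Submodule.mem_span_set'.1 hw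
  have hg (j : Fin k) : IsSmooth (g j).1 ∧ tensorInterp m n (g j).1 = (g j).1 := by
    obtain ⟨i, p, hp, hw⟩ := (g j).2
    rw [hw]
    exact ⟨isSmooth_rankOne i p, tensorInterp_rankOne hn i hp⟩
  rw [tensorInterp_sum_smul (by omega) c fun j => (hg j).1]
  simp only [(hg _).2]

theorem sameTraces_tensorInterp (hn : 2 * m + 1 ≤ n) {u v : Form N ν} (hu : IsSmooth u)
    (hv : IsSmooth v) {l : Fin N} {a b : ℝ} (ha : a = 0 ∨ a = 1) (hb : b = 0 ∨ b = 1)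
    (h : SameTraces m l a b u v) :
    SameTraces m l a b (tensorInterp m n u) (tensorInterp m n v) := by
  intro i γ hγ x _
  have hmem {s : ℝ} (hs : s = 0 ∨ s = 1) : s ∈ Icc (0 : ℝ) 1 := by
    rcases hs with rfl | rfl <;> simp
  rw [coeff_tensorInterp (by omega), coeff_tensorInterp (by omega)]
  refine partialDeriv_tensorOp_eq_of_partialDeriv_eq (hmem ha) (hmem hb) (fun s hs g hg => ?_)
    (hu.coeff i) (hv.coeff i) (h i γ hγ) x
  exact iteratedDerivWithin_op_element hn hγ hg (by rcases hs with rfl | rfl <;> assumption)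

end Interpolation

end TPFE

end

theorem lemma2 (N m n : ℕ) (hn : 2 * m + 1 ≤ n) (ν : ℕ) :
    -- the interpolation operators are cochain maps
    (∀ u : TPFE.Form N ν, TPFE.IsSmooth u →
      Set.EqOn (TPFE.tensorInterp m n (TPFE.dForm u)) (TPFE.dForm (TPFE.tensorInterp m n u))
        (TPFE.cube N)) ∧
    -- the tensor product spaces form a subcomplex of the smooth de Rham complex
    (∀ w ∈ TPFE.tensorSpace n N ν, TPFE.IsSmooth w ∧
      ∃ w' ∈ TPFE.tensorSpace n N (ν + 1), Set.EqOn (TPFE.dForm w) w' (TPFE.cube N)) ∧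
    -- interpolation is a projection onto the tensor product space
    (∀ u : TPFE.Form N ν, TPFE.IsSmooth u →
      TPFE.tensorInterp m n u ∈ TPFE.tensorSpace n N ν) ∧
    (∀ w ∈ TPFE.tensorSpace n N ν, Set.EqOn (TPFE.tensorInterp m n w) w (TPFE.cube N)) ∧
    -- conformity: matching traces of order `m` across a face are preserved by interpolation
    (∀ u v : TPFE.Form N ν, TPFE.IsSmooth u → TPFE.IsSmooth v →
      ∀ (l : Fin N) (a b : ℝ), (a = 0 ∨ a = 1) → (b = 0 ∨ b = 1) →
        TPFE.SameTraces m l a b u v →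
        TPFE.SameTraces m l a b (TPFE.tensorInterp m n u) (TPFE.tensorInterp m n v)) := by
  refine ⟨fun u hu => TPFE.tensorInterp_dForm hn hu, fun w hw => ?_,
    fun u hu => TPFE.tensorInterp_mem_tensorSpace hn hu,
    fun w hw x _ => congrFun (TPFE.tensorInterp_eq_self hn hw) x,
    fun u v hu hv l a b ha hb h => TPFE.sameTraces_tensorInterp hn hu hv ha hb h⟩
  have hsmooth := TPFE.IsSmooth.of_mem_tensorSpace hw
  refine ⟨hsmooth, TPFE.tensorInterp m n (TPFE.dForm w),
    TPFE.tensorInterp_mem_tensorSpace hn (TPFE.isSmooth_dForm hsmooth), fun x hx => ?_⟩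
  rw [TPFE.tensorInterp_dForm hn hsmooth hx, TPFE.tensorInterp_eq_self hn hw]
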